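/- Conventions: $[x,y]=x^{-1}y^{-1}xy$ and $x^z=z^{-1}xz$. For a group $G$ with commutator subgroup $G'$: - An *AI-automorphism* of $G$ is an automorphism of $G$ that induces inversion $x\mapsto x^{-1}$ on $G/G'$. - $K(G,n)=\{(g_1,\dots,g_n)\in G^n : g_1\cdots g_n\in G'\}$ is the kernel of the map $G^n\to G/G'$, $(g_1,\dots,g_n)\mapsto g_1\cdots g_nG'$. - For a free presentation $F\to G$ (a surjective homomorphism from a free group $F$) with kernel $N$, $\tilde K(G,n)=K(F,n)/K(N,n)^{F^n}$, where $K(N,n)^{F^n}$ is the normal closure of $K(N,n)$ in $F^n$. - Let $G^*$ be a copy of $G$ with isomorphism $g\mapsto g^*$. Then $\nu(G)$ is the quotient of the free product $G\star G^*$ by the normal closure of all $[x,y^*]^z\,[x^z,(y^z)^*]^{-1}$ and $[x,y^*]^{(z^*)}\,[x^z,(y^z)^*]^{-1}$ with $x,y,z\in G$; and $\tau(G)=\nu(G)/\nabla(G)$, where $\nabla(G)=\langle [x,x^*] : x\in G\rangle\le \nu(G)$. - $M(G)=H^2(G,\mathbb C^\times)$ (trivial action) is the Schur multiplier. **Proposition.**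 Let $G$ be a finite group. All Sylow subgroups of $G$ are cyclic if and only if there are integers $n\ge 1$, $m$ and $r$ with $m$ odd, $0\le r<m$, $r^n\equiv 1 \bmod m$ and $\gcd(m,n(r-1))=1$ such that $$G\cong\langle a,b\mid b^n,\ a^m,\ a^b=a^r\rangle. \qquad (*)$$ Suppose that all Sylow subgroups of $G$ are cyclic. Then $M(G)=1$, and for every free presentation of $G$ the canonical homomorphism $\tilde K(G,3)\to K(G,3)$ is an isomorphism. Moreover: (a) If $n,m,r$ satisfy the conditions above and $(*)$ holds, then $|G|=mn$ and $G\cong C_n\ltimes C_m$, and $G$ has an AI-automorphism if and only if $G$ is abelian, or $n$ is even, $r^2\equiv 1\bmod m$ and $\gcd(r+1,m)\neq 1$. (b) If $|G|$ is square-free, then $G$ has an AI-automorphism if and only if $G$ has a cyclic Hall $2'$-subgroup, that is, a cyclic subgroup of odd order whose index is a power of $2$. (c) For every free presentation of $G$ used to define $\tilde K(G,3)$: $\tau(G)\cong\tilde K(G,3)$ if and only if $G$ has an AI-automorphism. -/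

import Mathlib

/-- The map `Gⁿ → G/G'` sending a tuple to the product of its components modulo `G'`. -/
def prodAb (G : Type*) [Group G] (n : ℕ) : (Fin n → G) →* Abelianization G where
  toFun g := ∏ i, Abelianization.of (g i)
  map_one' := by simp
  map_mul' g h := by simp [Finset.prod_mul_distrib]

/-- `K(G, n)`, the kernel of the map `Gⁿ → G/G'`. -/
def liedtkeK (G : Type*) [Group G] (n : ℕ) : Subgroup (Fin n → G) :=
  (prodAb G n).ker

theorem mem_liedtkeK {G : Type*} [Group G] {n : ℕ} (g : Fin n → G) :
    g ∈ liedtkeK G n ↔ (List.ofFn g).prod ∈ commutator G := by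
  rw [← Abelianization.ker_of G, MonoidHom.mem_ker, map_list_prod, List.map_ofFn, List.prod_ofFn,
    liedtkeK, MonoidHom.mem_ker]
  rfl

/-- For a free presentation `π : F → G` with kernel `N`: the normal closure in `Fⁿ` of
`K(N, n)`, regarded as a subgroup of `Fⁿ`. -/
def relK {F G : Type*} [Group F] [Group G] (π : F →* G) (n : ℕ) : Subgroup (Fin n → F) :=
  Subgroup.normalClosure
    ((liedtkeK π.ker n).map (π.ker.subtype.compLeft (Fin n)) : Set (Fin n → F))

instance relK_normal {F G : Type*} [Group F] [Group G] (π : F →* G) (n : ℕ) :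
    (relK π n).Normal := Subgroup.normalClosure_normal

/-- `K̃(G, n) = K(F, n) / K(N, n)^{Fⁿ}`, for a free presentation `π : F → G` with kernel `N`. -/
abbrev KTilde {F G : Type*} [Group F] [Group G] (π : F →* G) (n : ℕ) : Type _ :=
  liedtkeK F n ⧸ (relK π n).subgroupOf (liedtkeK F n)

theorem map_mem_liedtkeK {F G : Type*} [Group F] [Group G] (π : F →* G) {n : ℕ}
    {f : Fin n → F} (hf : f ∈ liedtkeK F n) : π.compLeft (Fin n) f ∈ liedtkeK G n := by
  have h : prodAb G n (π.compLeft (Fin n) f) = Abelianization.map π (prodAb F n f) := by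
    simp [prodAb, map_prod]
  rw [liedtkeK, MonoidHom.mem_ker] at hf ⊢
  rw [h, hf, map_one]

/-- The homomorphism `K(F, n) → K(G, n)` applying `π : F → G` to every component. -/
def liedtkeKMap {F G : Type*} [Group F] [Group G] (π : F →* G) (n : ℕ) :
    liedtkeK F n →* liedtkeK G n :=
  ((π.compLeft (Fin n)).comp (liedtkeK F n).subtype).codRestrict (liedtkeK G n)
    fun f => map_mem_liedtkeK π f.2

theorem relK_le_ker {F G : Type*} [Group F] [Group G] (π : F →* G) (n : ℕ) :
    (relK π n).subgroupOf (liedtkeK F n) ≤ (liedtkeKMap π n).ker := by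
  have h : relK π n ≤ (π.compLeft (Fin n)).ker := by
    refine Subgroup.normalClosure_le_normal ?_
    rintro _ ⟨k, -, rfl⟩
    rw [SetLike.mem_coe, MonoidHom.mem_ker]
    funext i
    exact (k i).2
  intro f hf
  rw [MonoidHom.mem_ker]
  exact Subtype.ext (MonoidHom.mem_ker.1 (h hf))

/-- The canonical homomorphism `K̃(G, n) → K(G, n)`. -/
def KTilde.toK {F G : Type*} [Group F] [Group G] (π : F →* G) (n : ℕ) :
    KTilde π n →* liedtkeK G n :=
  QuotientGroup.lift _ (liedtkeKMap π n) (relK_le_ker π n)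

/-- The commutator `[x, y] = x⁻¹ y⁻¹ x y`. -/
def rcomm {G : Type*} [Group G] (x y : G) : G := x⁻¹ * y⁻¹ * x * y

/-- The conjugate `x ^ z = z⁻¹ x z`. -/
def rconj {G : Type*} [Group G] (x z : G) : G := z⁻¹ * x * z

open Monoid.Coprod in
/-- The relators `[x, y*]^z [x^z, (y^z)*]⁻¹` and `[x, y*]^(z*) [x^z, (y^z)*]⁻¹` of `ν(G)` in the
free product `G ⋆ G*`, with `G = inl G` and `G* = inr G`. -/
def nuRels (G : Type*) [Group G] : Set (Monoid.Coprod G G) :=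
  {w | ∃ x y z : G,
    w = rconj (rcomm (inl x) (inr y)) (inl z) * (rcomm (inl (rconj x z)) (inr (rconj y z)))⁻¹ ∨
    w = rconj (rcomm (inl x) (inr y)) (inr z) * (rcomm (inl (rconj x z)) (inr (rconj y z)))⁻¹}

/-- The group `ν(G)`. -/
abbrev Nu (G : Type*) [Group G] : Type _ :=
  Monoid.Coprod G G ⧸ Subgroup.normalClosure (nuRels G)

/-- The map `G → ν(G)`, `g ↦ g`. -/
def Nu.left (G : Type*) [Group G] : G →* Nu G :=
  (QuotientGroup.mk' (Subgroup.normalClosure (nuRels G))).comp Monoid.Coprod.inl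

/-- The map `G → ν(G)`, `g ↦ g*`. -/
def Nu.right (G : Type*) [Group G] : G →* Nu G :=
  (QuotientGroup.mk' (Subgroup.normalClosure (nuRels G))).comp Monoid.Coprod.inr

/-- The subgroup `∇(G)` of `ν(G)` generated by all `[x, x*]`. -/
def nabla (G : Type*) [Group G] : Subgroup (Nu G) :=
  Subgroup.closure {w | ∃ x : G, w = rcomm (Nu.left G x) (Nu.right G x)}

theorem Nu.rconj_left (G : Type*) [Group G] (x y z : G) :
    rconj (rcomm (Nu.left G x) (Nu.right G y)) (Nu.left G z) =
      rcomm (Nu.left G (rconj x z)) (Nu.right G (rconj y z)) := by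
  have h := (QuotientGroup.eq_one_iff (N := Subgroup.normalClosure (nuRels G)) _).2
    (Subgroup.subset_normalClosure (show _ ∈ nuRels G from ⟨x, y, z, Or.inl rfl⟩))
  exact mul_inv_eq_one.1 h

theorem Nu.rconj_right (G : Type*) [Group G] (x y z : G) :
    rconj (rcomm (Nu.left G x) (Nu.right G y)) (Nu.right G z) =
      rcomm (Nu.left G (rconj x z)) (Nu.right G (rconj y z)) := by
  have h := (QuotientGroup.eq_one_iff (N := Subgroup.normalClosure (nuRels G)) _).2
    (Subgroup.subset_normalClosure (show _ ∈ nuRels G from ⟨x, y, z, Or.inr rfl⟩))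
  exact mul_inv_eq_one.1 h

instance nabla_normal (G : Type*) [Group G] : (nabla G).Normal := by
  have key : ∀ t : Nu G,
      (∀ x, ∃ y, rconj (rcomm (Nu.left G x) (Nu.right G x)) t =
        rcomm (Nu.left G y) (Nu.right G y)) →
      ∀ w ∈ nabla G, t⁻¹ * w * t ∈ nabla G := by
    intro t ht w hw
    induction hw using Subgroup.closure_induction with
    | mem w hw =>
      obtain ⟨x, rfl⟩ := hw
      obtain ⟨y, hy⟩ := ht x
      exact Subgroup.subset_closure ⟨y, hy⟩
    | one => simp
    | mul u v _ _ hu hv => simpa [mul_assoc] using (nabla G).mul_mem hu hv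
    | inv u _ hu => simpa [mul_assoc] using (nabla G).inv_mem hu
  have all : ∀ t : Monoid.Coprod G G, ∀ w ∈ nabla G,
      (QuotientGroup.mk' (Subgroup.normalClosure (nuRels G)) t)⁻¹ * w *
        QuotientGroup.mk' (Subgroup.normalClosure (nuRels G)) t ∈ nabla G := by
    intro t
    induction t using Monoid.Coprod.induction_on with
    | inl z => exact key (Nu.left G z) fun x => ⟨_, Nu.rconj_left G x x z⟩
    | inr z => exact key (Nu.right G z) fun x => ⟨_, Nu.rconj_right G x x z⟩
    | mul s t hs ht =>
      intro w hw
      simpa [mul_assoc] using ht _ (hs w hw)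
  refine ⟨fun w hw g => ?_⟩
  obtain ⟨t, ht⟩ := QuotientGroup.mk'_surjective (Subgroup.normalClosure (nuRels G)) g⁻¹
  have h := all t w hw
  rwa [ht, inv_inv] at h

/-- `τ(G) = ν(G) / ∇(G)`. -/
abbrev Tau (G : Type*) [Group G] : Type _ := Nu G ⧸ nabla G

/-- An AI-automorphism: an automorphism of `G` inducing inversion on `G/G'`. -/
def IsAIAut {G : Type*} [Group G] (α : MulAut G) : Prop :=
  ∀ g : G, Abelianization.of (α g) = (Abelianization.of g)⁻¹

/-- `H` is a Hall `π`-subgroup of the finite group `G`. -/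
def IsHallSubgroup {G : Type*} [Group G] (π : Set ℕ) (H : Subgroup G) : Prop :=
  ∀ p : ℕ, p.Prime → (p ∣ Nat.card H → p ∈ π) ∧ (p ∣ H.index → p ∉ π)

/-- The group with presentation `⟨a, b | bⁿ, aᵐ, a^b = a^r⟩`, where `a` is the generator `0` and
`b` the generator `1`. -/
abbrev HolderGroup (n m r : ℕ) : Type :=
  PresentedGroup ({FreeGroup.of 1 ^ n, FreeGroup.of 0 ^ m,
    rconj (FreeGroup.of 0) (FreeGroup.of 1) * (FreeGroup.of 0 ^ r)⁻¹} : Set (FreeGroup (Fin 2)))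

/-- The numerical conditions on the parameters in the classification of the finite groups all of
whose Sylow subgroups are cyclic. -/
structure IsHolderParam (n m r : ℕ) : Prop where
  n_pos : 0 < n
  m_odd : Odd m
  r_lt : r < m
  pow_modEq : r ^ n ≡ 1 [MOD m]
  gcd_eq : Int.gcd (m : ℤ) ((n : ℤ) * ((r : ℤ) - 1)) = 1

universe u in
/-- The Schur multiplier `M(G) = H²(G, ℂˣ)`, with trivial action on `ℂˣ`; the coefficient ring `ℤ`
and the group `ℂˣ` are lifted to the universe of `G`. -/
noncomputable abbrev SchurMultiplier (G : Type u) [Group G] : Type u :=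
  groupCohomology.H2 (Rep.trivial (ULift.{u} ℤ) G (ULift.{u} (Additive ℂˣ)))

/-! A finite Z-group is `⟨b⟩ ⋉ ⟨a⟩` with `G' = ⟨a⟩` of order `m` prime to `n` and `b` acting by `r`,
where `r - 1` is a unit modulo `m`. This last fact drives everything.

AI-automorphisms: one must invert `b` modulo `⟨a⟩`, so `b` and `b⁻¹` act alike on `⟨a⟩`, that is,
`r² ≡ 1`. Conversely `a ↦ a`, `b ↦ b⁻¹` then works (`exists_isAIAut_iff`). Parts (a) and (b) are
arithmetic on top of this.

Central extensions: any lift of `a` can be corrected by a central element so that the relations `a^m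
= 1` and `a^b = a^r` hold upstairs (`exists_lift_of_ker_le_center`). If the kernel has `n`-th roots,
`b^n = 1` can be lifted too and the extension splits, so `M(G) = 1`. In general the commutator
subgroup meets the kernel trivially. For `F/[N,F]` this says `F' ∩ N = [N,F]`, which gives `K̃(G,3)
≅ K(G,3)`.

The group `τ(G)`: sending `g` to `(g,1,g)` and `g*` to `(1,g,g)` embeds it in `G³` with image `T =
{x₀x₁ ≡ x₂ mod G'}`, because the kernel lies in `⟨[a,b*]⟩`, which has order dividing `m` and maps
injectively.

Part (c) thus compares `T` with `K = {x₀x₁x₂ ∈ G'}`. An AI-automorphism in the third coordinate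
carries `T` to `K`. Conversely, an isomorphism preserves `⟨a⟩³`, the set of elements killed by `m`,
and hence the determinants of conjugation on it. On `K` these are `1`, while `(b,1,b) ∈ T` has
determinant `r²`. -/

/-- `a` and `b` generate `G` subject to the relations of `HolderGroup n m r`, and `G` has the order
of that group. -/
structure IsHolderPair {G : Type*} [Group G] (n m r : ℕ) (a b : G) : Prop where
  param : IsHolderParam n m r
  pow_a : a ^ m = 1
  pow_b : b ^ n = 1
  conj : b⁻¹ * a * b = a ^ r
  closure_eq : Subgroup.closure {a, b} = ⊤
  card_eq : Nat.card G = m * n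

/-! ### Arithmetic of the parameters and the normal form. -/

namespace IsHolderParam

variable {n m r : ℕ} (h : IsHolderParam n m r)
include h

theorem m_pos : 0 < m := h.m_odd.pos

theorem isCoprime_sub_one : IsCoprime ((r : ℤ) - 1) (m : ℤ) :=
  (Int.isCoprime_iff_gcd_eq_one.2 h.gcd_eq).symm.of_mul_left_right

theorem coprime : Nat.Coprime m n :=
  Nat.isCoprime_iff_coprime.1
    (Int.isCoprime_iff_gcd_eq_one.2 h.gcd_eq).symm.of_mul_left_left.symm

theorem coprime_r : Nat.Coprime r m := by
  refine Nat.Coprime.coprime_dvd_left (dvd_pow_self r h.n_pos.ne') ?_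
  rw [Nat.coprime_iff_gcd_eq_one, h.pow_modEq.gcd_eq, Nat.gcd_one_left]

end IsHolderParam

/-- Elements of a group generated by `a` and `b` are products `b ^ i * a ^ j` if `b` normalizes
`⟨a⟩`. -/
theorem exists_eq_pow_mul_pow {G : Type*} [Group G] {n m r : ℕ} (hn : 0 < n) (hm : 0 < m) {a b : G}
    (ha : a ^ m = 1) (hb : b ^ n = 1) (hab : b⁻¹ * a * b = a ^ r)
    (hcl : Subgroup.closure {a, b} = ⊤) (g : G) : ∃ i j : ℕ, g = b ^ i * a ^ j := by
  have hab' : ∀ j : ℕ, a ^ j * b = b * a ^ (r * j) := by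
    intro j
    have : b⁻¹ * a ^ j * b = a ^ (r * j) := by
      rw [pow_mul, ← hab]
      simpa using (conj_pow (i := j) (a := b⁻¹) (b := a)).symm
    rw [← this]; group
  have hmul : ∀ g : G, (∃ i j : ℕ, g = b ^ i * a ^ j) → ∀ k : ℕ,
      ∃ i j : ℕ, g * b ^ k = b ^ i * a ^ j := by
    intro g hg k
    induction k with
    | zero => simpa using hg
    | succ k ih =>
      obtain ⟨i, j, h⟩ := ih
      refine ⟨i + 1, r * j, ?_⟩
      rw [pow_succ, ← mul_assoc, h, mul_assoc, hab', pow_succ, mul_assoc]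
  have hg : g ∈ Subgroup.closure {a, b} := hcl ▸ Subgroup.mem_top g
  induction hg using Subgroup.closure_induction_right with
  | one => exact ⟨0, 0, by simp⟩
  | mul_right x _ y hy ih =>
    rcases hy with rfl | rfl
    · obtain ⟨i, j, rfl⟩ := ih
      exact ⟨i, j + 1, by rw [pow_succ, mul_assoc]⟩
    · simpa using hmul x ih 1
  | mul_inv_cancel x _ y hy ih =>
    rcases hy with rfl | rfl
    · obtain ⟨i, j, rfl⟩ := ih
      refine ⟨i, j + (m - 1), ?_⟩
      rw [mul_assoc, pow_add, inv_eq_of_mul_eq_one_right (a := y) (b := y ^ (m - 1))]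
      rw [← pow_succ', Nat.sub_add_cancel hm, ha]
    · rw [inv_eq_of_mul_eq_one_right (a := y) (b := y ^ (n - 1))]
      · exact hmul x ih _
      · rw [← pow_succ', Nat.sub_add_cancel hn, hb]

/-- The cardinality is at most the product of the orders of the generators. -/
theorem card_le_of_normal_form {G : Type*} [Group G] {n m : ℕ} (hn : 0 < n) (hm : 0 < m) {a b : G}
    (ha : a ^ m = 1) (hb : b ^ n = 1) (h : ∀ g : G, ∃ i j : ℕ, g = b ^ i * a ^ j) :
    Finite G ∧ Nat.card G ≤ m * n := by
  have hs : Function.Surjective fun p : Fin m × Fin n => b ^ (p.2 : ℕ) * a ^ (p.1 : ℕ) := by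
    intro g
    obtain ⟨i, j, rfl⟩ := h g
    refine ⟨(⟨j % m, Nat.mod_lt _ hm⟩, ⟨i % n, Nat.mod_lt _ hn⟩), ?_⟩
    simp only
    rw [← pow_eq_pow_mod i hb, ← pow_eq_pow_mod j ha]
  refine ⟨Finite.of_surjective _ hs, ?_⟩
  simpa using Nat.card_le_card_of_surjective _ hs

/-! ### The presented group and its semidirect product model. -/

namespace HolderGroup

variable (n m r : ℕ)

/-- The first generator of `HolderGroup`. -/
def a : HolderGroup n m r := PresentedGroup.of 0

/-- The second generator of `HolderGroup`. -/
def b : HolderGroup n m r := PresentedGroup.of 1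

theorem a_pow : a n m r ^ m = 1 :=
  (PresentedGroup.one_of_mem (x := (FreeGroup.of 0 ^ m : FreeGroup (Fin 2))) (by simp))

theorem b_pow : b n m r ^ n = 1 :=
  (PresentedGroup.one_of_mem (x := (FreeGroup.of 1 ^ n : FreeGroup (Fin 2))) (by simp))

theorem conj : (b n m r)⁻¹ * a n m r * b n m r = a n m r ^ r :=
  mul_inv_eq_one.1 (PresentedGroup.one_of_mem
    (x := (rconj (FreeGroup.of 0) (FreeGroup.of 1) * (FreeGroup.of 0 ^ r)⁻¹ : FreeGroup (Fin 2)))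
    (by simp))

theorem closure_eq : Subgroup.closure {a n m r, b n m r} = ⊤ := by
  rw [← PresentedGroup.closure_range_of]
  congr 1
  ext x
  simp [Fin.exists_fin_two, a, b, eq_comm]

variable {n m r}

/-- The universal property of `HolderGroup`. -/
theorem exists_hom {H : Type*} [Group H] {x y : H} (hx : x ^ m = 1) (hy : y ^ n = 1)
    (hxy : y⁻¹ * x * y = x ^ r) :
    ∃ f : HolderGroup n m r →* H, f (a n m r) = x ∧ f (b n m r) = y := by
  have hrel : ∀ w ∈ ({FreeGroup.of 1 ^ n, FreeGroup.of 0 ^ m,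
      rconj (FreeGroup.of 0) (FreeGroup.of 1) * (FreeGroup.of 0 ^ r)⁻¹} :
      Set (FreeGroup (Fin 2))), FreeGroup.lift ![x, y] w = 1 := by
    rintro w (rfl | rfl | rfl) <;> simp [hx, hy, rconj, hxy]
  exact ⟨PresentedGroup.toGroup hrel, by simp [a], by simp [b]⟩

end HolderGroup

/-- The action of `C_n` on `C_m` defining the semidirect product isomorphic to `HolderGroup`. -/
theorem IsHolderParam.exists_action {n m r : ℕ} (h : IsHolderParam n m r) :
    ∃ φ : Multiplicative (ZMod n) →* MulAut (Multiplicative (ZMod m)),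
      ∀ x, φ (Multiplicative.ofAdd 1) x = x ^ r := by
  let u : (ZMod m)ˣ := ZMod.unitOfCoprime r h.coprime_r
  have hu : u ^ n = 1 := by
    ext
    simpa [u] using (ZMod.natCast_eq_natCast_iff _ _ _).2 h.pow_modEq
  let ψ : ZMod n →+ Additive (ZMod m)ˣ :=
    ZMod.lift n ⟨zmultiplesHom _ (Additive.ofMul u), by
      rw [zmultiplesHom_apply, natCast_zsmul, ← ofMul_pow, hu, ofMul_one]⟩
  refine ⟨(MulAutMultiplicative (ZMod m)).symm.toMonoidHom.comp
    ((DistribMulAction.toAddAut (ZMod m)ˣ (ZMod m)).comp (AddMonoidHom.toMultiplicativeLeft ψ)), ?_⟩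
  intro x
  have h1 : ψ 1 = Additive.ofMul u := by
    simpa [ψ] using ZMod.lift_coe n (⟨zmultiplesHom _ (Additive.ofMul u), by
      rw [zmultiplesHom_apply, natCast_zsmul, ← ofMul_pow, hu, ofMul_one]⟩ :
        {f : ℤ →+ Additive (ZMod m)ˣ // f n = 0}) 1
  have h2 : AddMonoidHom.toMultiplicativeLeft ψ (Multiplicative.ofAdd 1) = u := h1
  simp only [MonoidHom.comp_apply, h2]
  apply Multiplicative.toAdd.injective
  rw [toAdd_pow, nsmul_eq_mul]
  rfl

/-- A semidirect product of cyclic groups satisfying the relations of `HolderGroup`. -/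
theorem IsHolderParam.exists_isHolderPair_semidirectProduct {n m r : ℕ}
    (h : IsHolderParam n m r) :
    ∃ φ : Multiplicative (ZMod n) →* MulAut (Multiplicative (ZMod m)),
      ∃ a b : Multiplicative (ZMod m) ⋊[φ] Multiplicative (ZMod n), IsHolderPair n m r a b := by
  obtain ⟨φ, hφ⟩ := h.exists_action
  have := NeZero.of_pos h.n_pos
  have := NeZero.of_pos h.m_pos
  have key : ∀ k : ℕ, ∀ x : Multiplicative (ZMod k), ∃ i : ℤ, Multiplicative.ofAdd 1 ^ i = x := by
    intro k x
    obtain ⟨i, hi⟩ := ZMod.intCast_surjective x.toAdd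
    exact ⟨i, Multiplicative.toAdd.injective (by simpa using hi)⟩
  -- Conjugation by `inr g` on the left is `φ g`, whereas the relation has `b⁻¹ * a * b`; hence the
  -- inverse in the choice of `b`.
  refine ⟨φ, SemidirectProduct.inl (Multiplicative.ofAdd 1),
    (SemidirectProduct.inr (Multiplicative.ofAdd 1))⁻¹, h, ?_, ?_, ?_, ?_, ?_⟩
  · rw [← map_pow, ← ofAdd_nsmul]; simp
  · rw [inv_pow, ← map_pow, ← ofAdd_nsmul]; simp
  · rw [inv_inv, ← map_inv, ← SemidirectProduct.inl_aut, hφ, map_pow]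
  · rw [eq_top_iff]
    intro g _
    rw [← SemidirectProduct.inl_left_mul_inr_right g]
    obtain ⟨i, hi⟩ := key _ g.left
    obtain ⟨j, hj⟩ := key _ g.right
    rw [← hi, ← hj, map_zpow, map_zpow]
    refine mul_mem (zpow_mem (Subgroup.subset_closure (by simp)) _) (zpow_mem ?_ _)
    rw [← inv_mem_iff]
    exact Subgroup.subset_closure (by simp)
  · rw [SemidirectProduct.card]
    simp

/-! ### Structure of a group with generators `a`, `b`. -/

namespace IsHolderPair

variable {G : Type*} [Group G] {n m r : ℕ} {a b : G}

theorem map {H : Type*} [Group H] (e : G ≃* H) (h : IsHolderPair n m r a b) :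
    IsHolderPair n m r (e a) (e b) where
  param := h.param
  pow_a := by rw [← map_pow, h.pow_a, map_one]
  pow_b := by rw [← map_pow, h.pow_b, map_one]
  conj := by rw [← map_inv, ← map_mul, ← map_mul, h.conj, map_pow]
  closure_eq := by
    have := congrArg (Subgroup.map e.toMonoidHom) h.closure_eq
    rwa [MonoidHom.map_closure, Set.image_pair, Subgroup.map_top_of_surjective _ e.surjective]
      at this
  card_eq := by rw [← Nat.card_congr e.toEquiv, h.card_eq]

variable (h : IsHolderPair n m r a b)
include h

theorem finite : Finite G :=
  Nat.finite_of_card_ne_zero (by rw [h.card_eq]; exact (mul_pos h.param.m_pos h.param.n_pos).ne')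

theorem exists_pow (g : G) : ∃ i j : ℕ, g = b ^ i * a ^ j :=
  exists_eq_pow_mul_pow h.param.n_pos h.param.m_pos h.pow_a h.pow_b h.conj h.closure_eq g

theorem ext_hom {H : Type*} [Group H] {f g : G →* H} (ha : f a = g a) (hb : f b = g b) :
    f = g :=
  MonoidHom.eq_of_eqOn_dense h.closure_eq (by rintro x (rfl | rfl) <;> assumption)

/-- The normal form bounds the order of the presented group by `m * n`, the order of `G`, so the
surjection onto `G` is injective. -/
theorem exists_equiv : ∃ e : HolderGroup n m r ≃* G,
    e (HolderGroup.a n m r) = a ∧ e (HolderGroup.b n m r) = b := by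
  obtain ⟨f, hfa, hfb⟩ := HolderGroup.exists_hom h.pow_a h.pow_b h.conj
  have := h.finite
  obtain ⟨hfin, hcard⟩ := card_le_of_normal_form h.param.n_pos h.param.m_pos
    (HolderGroup.a_pow n m r) (HolderGroup.b_pow n m r)
    (exists_eq_pow_mul_pow h.param.n_pos h.param.m_pos
    (HolderGroup.a_pow n m r) (HolderGroup.b_pow n m r) (HolderGroup.conj n m r)
    (HolderGroup.closure_eq n m r))
  have hs : Function.Surjective f := by
    intro g
    obtain ⟨i, j, rfl⟩ := h.exists_pow g
    exact ⟨HolderGroup.b n m r ^ i * HolderGroup.a n m r ^ j, by simp [hfa, hfb]⟩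
  have hb : Function.Bijective f :=
    hs.bijective_of_nat_card_le (by rwa [h.card_eq])
  exact ⟨MulEquiv.ofBijective f hb, hfa, hfb⟩

theorem exists_hom {H : Type*} [Group H] {x y : H} (hx : x ^ m = 1) (hy : y ^ n = 1)
    (hxy : y⁻¹ * x * y = x ^ r) : ∃ f : G →* H, f a = x ∧ f b = y := by
  obtain ⟨e, rfl, rfl⟩ := h.exists_equiv
  obtain ⟨f, hfa, hfb⟩ := HolderGroup.exists_hom hx hy hxy
  exact ⟨f.comp e.symm.toMonoidHom, by simpa, by simpa⟩

/-- A smaller order of `a` in the normal form would make `G` smaller than `m * n`. -/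
theorem orderOf_a : orderOf a = m := by
  have := h.finite
  refine Nat.le_antisymm (orderOf_le_of_pow_eq_one h.param.m_pos h.pow_a) ?_
  have := (card_le_of_normal_form h.param.n_pos (orderOf_pos a) (pow_orderOf_eq_one a) h.pow_b
    h.exists_pow).2
  rw [h.card_eq] at this
  exact Nat.le_of_mul_le_mul_right this h.param.n_pos

theorem pow_eq_pow_iff (i j : ℕ) : a ^ i = a ^ j ↔ i ≡ j [MOD m] := by
  rw [_root_.pow_eq_pow_iff_modEq, h.orderOf_a]

theorem exists_proj : ∃ p : G →* Multiplicative (ZMod n), p a = 1 ∧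
    p b = Multiplicative.ofAdd 1 :=
  h.exists_hom (by simp) (by rw [← ofAdd_nsmul]; simp) (by simp)

theorem pow_b_mem_zpowers (i : ℕ) : b ^ i ∈ Subgroup.zpowers a ↔ n ∣ i := by
  obtain ⟨p, hpa, hpb⟩ := h.exists_proj
  constructor
  · rintro ⟨k, hk⟩
    have := congrArg p hk
    simp only [map_zpow, hpa, one_zpow, map_pow, hpb] at this
    rw [← ofAdd_nsmul, eq_comm, ofAdd_eq_one, nsmul_one] at this
    exact (ZMod.natCast_eq_zero_iff _ _).1 this
  · rintro ⟨k, rfl⟩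
    rw [pow_mul, h.pow_b, one_pow]
    exact one_mem _

/-- The quotient by `⟨a⟩` has order `n`, prime to `m`. This makes `⟨a⟩` recognizable under every
isomorphism. -/
theorem mem_zpowers_iff (x : G) : x ∈ Subgroup.zpowers a ↔ x ^ m = 1 := by
  constructor
  · rintro ⟨k, rfl⟩
    rw [← zpow_natCast, zpow_comm, zpow_natCast, h.pow_a, one_zpow]
  · intro hx
    obtain ⟨i, j, rfl⟩ := h.exists_pow x
    obtain ⟨p, hpa, hpb⟩ := h.exists_proj
    have := congrArg p hx
    simp only [map_mul, map_pow, hpa, one_pow, hpb, mul_one, map_one] at this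
    rw [← pow_mul, ← ofAdd_nsmul, ofAdd_eq_one, nsmul_one, ZMod.natCast_eq_zero_iff] at this
    exact mul_mem ((h.pow_b_mem_zpowers i).2 (h.param.coprime.symm.dvd_of_dvd_mul_right this))
      (pow_mem (Subgroup.mem_zpowers a) j)

/-- The commutator subgroup is `⟨a⟩`. -/
theorem commutator_eq : commutator G = Subgroup.zpowers a := by
  apply le_antisymm
  · have hle : commutator G ≤ (h.exists_proj.choose).ker := Abelianization.commutator_subset_ker _
    obtain ⟨hpa, hpb⟩ := h.exists_proj.choose_spec
    intro g hg
    have := MonoidHom.mem_ker.1 (hle hg)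
    obtain ⟨i, j, rfl⟩ := h.exists_pow g
    rw [map_mul, map_pow, map_pow, hpa, hpb, one_pow, mul_one, ← ofAdd_nsmul, ofAdd_eq_one,
      nsmul_one, ZMod.natCast_eq_zero_iff] at this
    exact mul_mem ((h.pow_b_mem_zpowers i).2 this) (pow_mem (Subgroup.mem_zpowers a) j)
  · rw [Subgroup.zpowers_le]
    -- `a ^ (r - 1)` is the commutator of `b⁻¹` and `a`; as `r - 1` is a unit modulo `m`, `a` is a
    -- power of it.
    obtain ⟨s, t, hst⟩ := h.param.isCoprime_sub_one
    have h1 : a ^ ((r : ℤ) - 1) ∈ commutator G := by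
      rw [zpow_sub, zpow_natCast, zpow_one, ← h.conj]
      have := Subgroup.commutator_mem_commutator (Subgroup.mem_top b⁻¹) (Subgroup.mem_top a)
      rwa [commutatorElement_def, inv_inv, ← commutator_def] at this
    have h2 : a = (a ^ ((r : ℤ) - 1)) ^ s := by
      rw [← zpow_mul, show ((r : ℤ) - 1) * s = 1 - t * m by linarith, zpow_sub, zpow_one]
      rw [mul_comm t, zpow_mul, zpow_natCast, h.pow_a]
      simp
    rw [h2]
    exact zpow_mem h1 s

theorem of_a : Abelianization.of a = 1 := by
  rw [← MonoidHom.mem_ker, Abelianization.ker_of, h.commutator_eq]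
  exact Subgroup.mem_zpowers a

/-- The character through which `G` acts on `⟨a⟩`. -/
theorem exists_character : ∃ χ : G →* (ZMod m)ˣ, χ a = 1 ∧ (χ b : ZMod m) = r := by
  obtain ⟨f, hfa, hfb⟩ := h.exists_hom (x := (1 : (ZMod m)ˣ))
    (y := ZMod.unitOfCoprime r h.param.coprime_r) (by simp)
    (by ext; simpa using (ZMod.natCast_eq_natCast_iff _ _ _).2 h.param.pow_modEq) (by simp)
  exact ⟨f, hfa, by rw [hfb]; simp⟩

end IsHolderPair

/-- The presentation by itself only bounds the order from above; the semidirect product shows that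
`m * n` is attained. -/
theorem exists_isHolderPair_of_equiv {G : Type*} [Group G] {n m r : ℕ} (h : IsHolderParam n m r)
    (e : G ≃* HolderGroup n m r) : ∃ a b : G, IsHolderPair n m r a b := by
  obtain ⟨φ, a, b, hab⟩ := h.exists_isHolderPair_semidirectProduct
  obtain ⟨e', -⟩ := hab.exists_equiv
  exact ⟨_, _, hab.map (e'.symm.trans e.symm)⟩

/-! ### AI-automorphisms: parts (a) and (b). -/

namespace IsHolderPair

variable {G : Type*} [Group G] {n m r : ℕ} {a b : G}

theorem ext_abelianization (h : IsHolderPair n m r a b) {f g : Abelianization G →* Abelianization G}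
    (hb : f (.of b) = g (.of b)) : f = g := by
  refine Abelianization.hom_ext _ _ (h.ext_hom ?_ hb)
  simp [h.of_a]

theorem conj_pow (h : IsHolderPair n m r a b) (k : ℕ) : b⁻¹ * a ^ k * b = a ^ (r * k) := by
  rw [pow_mul, ← h.conj]
  simpa using (_root_.conj_pow (i := k) (a := b⁻¹) (b := a)).symm

/-- An AI-automorphism maps `a` to a power of `a` and `b` into `b⁻¹⟨a⟩`. Since `⟨a⟩` is abelian, the
image of `a^b = a^r` says that `b⁻¹` also acts by `r`. -/
theorem exists_isAIAut_iff (h : IsHolderPair n m r a b) :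
    (∃ α : MulAut G, IsAIAut α) ↔ r ^ 2 ≡ 1 [MOD m] := by
  have := h.finite
  constructor
  · rintro ⟨α, hα⟩
    have h1 : α b * b ∈ commutator G := by
      rw [← Abelianization.ker_of, MonoidHom.mem_ker, map_mul, hα, inv_mul_cancel]
    have h2 : α a ∈ Subgroup.zpowers a := by
      rw [h.mem_zpowers_iff, ← map_pow, h.pow_a, map_one]
    rw [h.commutator_eq] at h1
    obtain ⟨i, hi⟩ := (mem_powers_iff_mem_zpowers).2 h1
    obtain ⟨k, hk⟩ := (mem_powers_iff_mem_zpowers).2 h2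
    simp only at hi hk
    have h3 := congrArg α h.conj
    rw [map_mul, map_mul, map_inv, map_pow, ← hk, eq_mul_inv_of_mul_eq hi.symm] at h3
    have h4 : b * a ^ k * b⁻¹ = (a ^ k) ^ r := by
      rw [← h3]
      have h0 : (a ^ i)⁻¹ * a ^ k * a ^ i = a ^ k := by
        rw [mul_assoc, ← pow_add, add_comm, pow_add, inv_mul_cancel_left]
      rw [mul_inv_rev, inv_inv]
      calc b * a ^ k * b⁻¹ = b * ((a ^ i)⁻¹ * a ^ k * a ^ i) * b⁻¹ := by rw [h0]
        _ = _ := by group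
    have h5 : a ^ k = a ^ (r ^ 2 * k) := by
      have : b⁻¹ * (b * a ^ k * b⁻¹) * b = a ^ k := by group
      rw [← this, h4, ← pow_mul, h.conj_pow]
      ring_nf
    have h6 : α (a ^ (r ^ 2)) = α a := by
      rw [map_pow, ← hk, ← pow_mul, mul_comm, ← h5]
    have h7 := α.injective h6
    rwa [← pow_one a, ← pow_mul, one_mul, h.pow_eq_pow_iff] at h7
  · intro hr
    have hbinv : b * a * b⁻¹ = a ^ r := by
      have : b⁻¹ * a ^ r * b = a := by
        rw [h.conj_pow, ← sq]
        conv_rhs => rw [← pow_one a]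
        rwa [h.pow_eq_pow_iff]
      rw [← this, ← mul_assoc, ← mul_assoc]
      simp [this]
    obtain ⟨f, hfa, hfb⟩ := h.exists_hom (x := a) (y := b⁻¹) h.pow_a (by simp [h.pow_b])
      (by rwa [inv_inv])
    have hff : f.comp f = MonoidHom.id G := h.ext_hom (by simp [hfa]) (by simp [hfb])
    have hff' : ∀ x, f (f x) = x := fun x => DFunLike.congr_fun hff x
    refine ⟨⟨⟨f, f, hff', hff'⟩, f.map_mul⟩, fun g => ?_⟩
    have := h.ext_abelianization (f := Abelianization.map f)
      (g := invMonoidHom) (by simp [hfb])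
    exact DFunLike.congr_fun this (Abelianization.of g)

theorem mul_comm_iff (h : IsHolderPair n m r a b) : (∀ x y : G, x * y = y * x) ↔ m = 1 := by
  constructor
  · intro hc
    have h1 := h.conj
    rw [hc, mul_inv_cancel_left, eq_comm] at h1
    nth_rw 2 [← pow_one a] at h1
    rw [h.pow_eq_pow_iff, Nat.modEq_iff_dvd, dvd_sub_comm] at h1
    have h2 := h.param.isCoprime_sub_one
    have h3 : IsCoprime (m : ℤ) (m : ℤ) := by
      obtain ⟨c, hc⟩ := h1
      rw [Nat.cast_one] at hc
      rw [hc] at h2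
      exact h2.of_mul_left_left
    have := isCoprime_self.1 h3
    rw [Int.isUnit_iff] at this
    omega
  · rintro rfl x y
    have ha : a = 1 := by simpa using h.pow_a
    obtain ⟨i, j, rfl⟩ := h.exists_pow x
    obtain ⟨k, l, rfl⟩ := h.exists_pow y
    simp only [ha, one_pow, mul_one, ← pow_add, add_comm]

/-- The numerical criterion for the existence of an AI-automorphism. -/
theorem exists_isAIAut_iff' (h : IsHolderPair n m r a b) :
    (∃ α : MulAut G, IsAIAut α) ↔ ((∀ x y : G, x * y = y * x) ∨
      (Even n ∧ r ^ 2 ≡ 1 [MOD m] ∧ Nat.gcd (r + 1) m ≠ 1)) := by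
  rw [h.exists_isAIAut_iff, h.mul_comm_iff]
  constructor
  · intro hr
    by_cases hm : m = 1
    · exact Or.inl hm
    refine Or.inr ⟨?_, hr, ?_⟩
    -- For odd `n`, `r² ≡ 1` gives `1 ≡ r^n ≡ r`, so `m` divides `r - 1`, to which it is coprime.
    · by_contra hn
      rw [Nat.not_even_iff_odd] at hn
      obtain ⟨k, rfl⟩ := hn
      have h1 := h.param.pow_modEq
      rw [pow_succ, pow_mul] at h1
      have h2 : r ≡ 1 [MOD m] := by
        simpa using (((hr.pow k).mul_right r).symm.trans h1)
      rw [Nat.modEq_iff_dvd, dvd_sub_comm] at h2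
      obtain ⟨c, hc⟩ := h2
      have h3 := h.param.isCoprime_sub_one
      rw [Nat.cast_one] at hc
      rw [hc] at h3
      have := isCoprime_self.1 h3.of_mul_left_left
      rw [Int.isUnit_iff] at this
      omega
    -- From `m ∣ (r - 1)(r + 1)` follows `m ∣ r + 1`, so the gcd is `m` itself.
    · rw [Nat.modEq_iff_dvd, dvd_sub_comm] at hr
      have h1 : (m : ℤ) ∣ ((r : ℤ) - 1) * ((r + 1 : ℕ) : ℤ) := by
        have h0 : ((r : ℤ) - 1) * ((r + 1 : ℕ) : ℤ) = ((r ^ 2 : ℕ) : ℤ) - (1 : ℕ) := by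
          push_cast
          ring
        rwa [h0]
      have h2 := h.param.isCoprime_sub_one.symm.dvd_of_dvd_mul_left h1
      rwa [Nat.gcd_eq_right (Int.natCast_dvd_natCast.1 h2)]
  · rintro (rfl | ⟨-, hr, -⟩)
    · exact Nat.modEq_one
    · exact hr

/-- A group of square-free order with an AI-automorphism has a cyclic Hall `2'`-subgroup, and
conversely. -/
theorem exists_isAIAut_iff_exists_isHallSubgroup (h : IsHolderPair n m r a b)
    (hsq : Squarefree (Nat.card G)) :
    (∃ α : MulAut G, IsAIAut α) ↔ ∃ H : Subgroup G, IsHallSubgroup {2}ᶜ H ∧ IsCyclic H := by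
  have := h.finite
  rw [h.exists_isAIAut_iff]
  constructor
  · intro hr
    -- Now `b²` centralizes `a`, so `b² * a` generates a cyclic group of index `gcd(n, 2)`. Its
    -- order is odd because square-freeness excludes `4 ∣ n`.
    have hcomm : Commute (b ^ 2) a := by
      have h1 : b⁻¹ * (b⁻¹ * a * b) * b = a := by
        rw [h.conj, h.conj_pow, ← sq]
        conv_rhs => rw [← pow_one a]
        rwa [h.pow_eq_pow_iff]
      have : b ^ 2 * (b⁻¹ * (b⁻¹ * a * b) * b) = a * b ^ 2 := by simp only [sq]; group
      rwa [h1] at this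
    have hbn : orderOf b = n := by
      refine Nat.dvd_antisymm (orderOf_dvd_of_pow_eq_one h.pow_b) ?_
      rw [← h.pow_b_mem_zpowers, pow_orderOf_eq_one]
      exact one_mem _
    have hord : orderOf (b ^ 2 * a) = n / n.gcd 2 * m := by
      have hb2 : orderOf (b ^ 2) = n / n.gcd 2 := by rw [orderOf_pow, hbn]
      rw [hcomm.orderOf_mul_eq_mul_orderOf_of_coprime, hb2, h.orderOf_a]
      rw [hb2, h.orderOf_a]
      exact (h.param.coprime.coprime_dvd_right (Nat.div_dvd_of_dvd (Nat.gcd_dvd_left n 2))).symm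
    have hcard : Nat.card (Subgroup.zpowers (b ^ 2 * a)) = n / n.gcd 2 * m := by
      rw [Nat.card_zpowers, hord]
    have hindex : (Subgroup.zpowers (b ^ 2 * a)).index = n.gcd 2 := by
      have h1 := Subgroup.card_mul_index (Subgroup.zpowers (b ^ 2 * a))
      rw [hcard, h.card_eq] at h1
      have h2 := Nat.div_mul_cancel (Nat.gcd_dvd_left n 2)
      have h3 : 0 < n / n.gcd 2 * m := by rw [← hord]; exact orderOf_pos _
      refine Nat.eq_of_mul_eq_mul_left h3 (h1.trans ?_)
      nth_rw 1 [← h2]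
      simp only [mul_comm, mul_left_comm]
    refine ⟨Subgroup.zpowers (b ^ 2 * a), fun p hp => ⟨?_, ?_⟩, Subgroup.isCyclic_zpowers _⟩
    · rw [hcard]
      rintro hdvd rfl
      rcases (Nat.Prime.dvd_mul hp).1 hdvd with h2 | h2
      · have hn2 : n.gcd 2 = 2 := Nat.gcd_eq_right
          (h2.trans (Nat.div_dvd_of_dvd (Nat.gcd_dvd_left n 2)))
        rw [hn2] at h2
        rw [h.card_eq] at hsq
        have h4 : 2 * 2 ∣ n := by
          have := Nat.mul_dvd_mul_left 2 h2
          rwa [Nat.mul_div_cancel' (hn2 ▸ Nat.gcd_dvd_left n 2)] at this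
        simpa using hsq 2 (h4.mul_left m)
      · exact (Nat.not_even_iff_odd.2 h.param.m_odd) (even_iff_two_dvd.2 h2)
    · rw [hindex]
      intro hdvd hne
      exact hne ((Nat.prime_dvd_prime_iff_eq hp Nat.prime_two).1
        (hdvd.trans (Nat.gcd_dvd_right n 2)))
  · rintro ⟨H, hH, hcyc⟩
    -- The index is a square-free power of `2`. Hence `H` contains all squares, in particular `b²`
    -- and, as `m` is odd, `a`; these commute because `H` is cyclic.
    have hindex : H.index ∣ 2 := by
      have hs : Squarefree H.index := hsq.squarefree_of_dvd H.index_dvd_card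
      obtain ⟨k, hk⟩ : ∃ k, H.index = 2 ^ k := ⟨_, Nat.eq_prime_pow_of_unique_prime_dvd
        H.index_ne_zero_of_finite fun {p} hp hd => by simpa using (hH p hp).2 hd⟩
      rw [hk] at hs ⊢
      rcases k with _ | _ | k
      · simp
      · simp
      · simpa using hs 2 ⟨2 ^ k, by ring⟩
    have hsqmem : ∀ g : G, g ^ 2 ∈ H := by
      intro g
      rcases (Nat.dvd_prime Nat.prime_two).1 hindex with h1 | h1
      · rw [Subgroup.index_eq_one.1 h1]; trivial
      · exact Subgroup.sq_mem_of_index_two h1 g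
    have haH : a ∈ H := by
      obtain ⟨k, hk⟩ := h.param.m_odd
      have : a = (a ^ (k + 1)) ^ 2 := by
        rw [← pow_mul, show (k + 1) * 2 = m + 1 by omega, pow_succ, h.pow_a, one_mul]
      rw [this]
      exact hsqmem _
    have hc : a * b ^ 2 = b ^ 2 * a := by
      let := hcyc.commGroup
      exact congrArg Subtype.val (mul_comm (⟨a, haH⟩ : H) ⟨b ^ 2, hsqmem b⟩)
    have h1 : b⁻¹ * (b⁻¹ * a * b) * b = a := by
      have : b⁻¹ * (b⁻¹ * a * b) * b = b⁻¹ ^ 2 * (a * b ^ 2) := by simp only [sq]; group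
      rw [this, hc]; group
    rw [h.conj, h.conj_pow, ← sq] at h1
    nth_rw 2 [← pow_one a] at h1
    rwa [h.pow_eq_pow_iff] at h1

end IsHolderPair

/-! ### Classification of the finite Z-groups. -/

/-- The commutator subgroup lies in a normal subgroup modulo which the generators commute. -/
theorem commutator_le_of_closure_eq_top {G : Type*} [Group G] {S : Set G} {N : Subgroup G}
    [N.Normal] (hS : Subgroup.closure S = ⊤)
    (h : ∀ s ∈ S, ∀ t ∈ S, Commute (s : G ⧸ N) (t : G ⧸ N)) : commutator G ≤ N := by
  have h1 : ∀ x : G, ∀ t ∈ S, Commute (x : G ⧸ N) (t : G ⧸ N) := by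
    intro x t ht
    have hx : x ∈ Subgroup.closure S := hS ▸ Subgroup.mem_top x
    induction hx using Subgroup.closure_induction with
    | mem x hx => exact h x hx t ht
    | one => exact Commute.one_left _
    | mul x y _ _ hx hy => exact hx.mul_left hy
    | inv x _ hx => exact hx.inv_left
  have h2 : ∀ x y : G, Commute (x : G ⧸ N) (y : G ⧸ N) := by
    intro x y
    have hy : y ∈ Subgroup.closure S := hS ▸ Subgroup.mem_top y
    induction hy using Subgroup.closure_induction with
    | mem y hy => exact h1 x y hy
    | one => exact Commute.one_right _
    | mul y z _ _ hy hz => exact hy.mul_right hz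
    | inv y _ hy => exact hy.inv_right
  rw [commutator_def, Subgroup.commutator_le]
  intro x _ y _
  rw [← QuotientGroup.eq_one_iff]
  exact commutatorElement_eq_one_iff_commute.2 (h2 x y)

/-- The classification of Z-groups. -/
theorem IsZGroup.exists_isHolderPair {G : Type*} [Group G] [Finite G] (hG : IsZGroup G) :
    ∃ (n m r : ℕ) (a b : G), IsHolderPair n m r a b := by
  -- In a Z-group the order and the index of `G'` are coprime. By Schur–Zassenhaus `G'` has a
  -- complement, which is cyclic because it is isomorphic to `G/G'`.
  obtain ⟨H, hH⟩ := Subgroup.exists_right_complement'_of_coprime hG.coprime_commutator_index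
  have h1 : Abelianization G ≃* H := hH.symm.QuotientMulEquiv
  have hHc : IsCyclic H := isCyclic_of_surjective _ h1.surjective
  have hNc := hG.isCyclic_commutator
  obtain ⟨b, hb⟩ := (Subgroup.isCyclic_iff_exists_zpowers_eq_top H).1 hHc
  obtain ⟨a, ha⟩ := (Subgroup.isCyclic_iff_exists_zpowers_eq_top _).1 hNc
  have hcard := hH.card_mul_card
  have hcop : (Nat.card (commutator G)).Coprime (Nat.card H) :=
    Nat.card_congr h1.toEquiv ▸ hG.coprime_commutator_index
  rw [← ha, ← hb, Nat.card_zpowers, Nat.card_zpowers] at hcard hcop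
  have hr0 : b⁻¹ * a * b ∈ Subgroup.zpowers a := by
    rw [ha]
    have := (inferInstance : (commutator G).Normal).conj_mem a (ha ▸ Subgroup.mem_zpowers a) b⁻¹
    rwa [inv_inv] at this
  obtain ⟨k, hk⟩ := (mem_powers_iff_mem_zpowers).2 hr0
  set r := k % orderOf a with hr
  have hconj : b⁻¹ * a * b = a ^ r := by rw [hr, pow_mod_orderOf]; exact hk.symm
  have hcl : Subgroup.closure {a, b} = ⊤ := by
    rw [Set.insert_eq, Subgroup.closure_union, ← Subgroup.zpowers_eq_closure,
      ← Subgroup.zpowers_eq_closure, ha, hb, hH.sup_eq_top]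
  have hnormal : (Subgroup.zpowers (a ^ ((r : ℤ) - 1))).Normal := by
    refine ⟨fun x hx g => ?_⟩
    obtain ⟨j, rfl⟩ := hx
    have h2 := (inferInstance : (commutator G).Normal).conj_mem (a ^ j)
      (ha ▸ zpow_mem (Subgroup.mem_zpowers a) j) g
    rw [← ha] at h2
    obtain ⟨i, hi⟩ := h2
    refine ⟨i, ?_⟩
    simp only at hi ⊢
    rw [zpow_comm, hi, conj_zpow, zpow_comm]
  -- Modulo `a ^ (r - 1)` the generators commute, so `⟨a⟩ = G'` is generated by `a ^ (r - 1)`; this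
  -- forces `r - 1` to be prime to the order of `a`.
  have hle : commutator G ≤ Subgroup.zpowers (a ^ ((r : ℤ) - 1)) := by
    refine commutator_le_of_closure_eq_top hcl ?_
    have h2 : ((a ^ ((r : ℤ) - 1) : G) : G ⧸ Subgroup.zpowers (a ^ ((r : ℤ) - 1))) = 1 :=
      (QuotientGroup.eq_one_iff _).2 (Subgroup.mem_zpowers _)
    have h3 : a * b = b * (a * a ^ ((r : ℤ) - 1)) := by
      rw [← zpow_one_add, add_sub_cancel, zpow_natCast, ← hconj]
      group
    have h4 : Commute (a : G ⧸ Subgroup.zpowers (a ^ ((r : ℤ) - 1))) b := by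
      have := congrArg (QuotientGroup.mk (s := Subgroup.zpowers (a ^ ((r : ℤ) - 1)))) h3
      rwa [QuotientGroup.mk_mul, QuotientGroup.mk_mul, QuotientGroup.mk_mul, h2, mul_one] at this
    rintro s (rfl | rfl) t (rfl | rfl)
    exacts [Commute.refl _, h4, h4.symm, Commute.refl _]
  have hra : IsCoprime ((r : ℤ) - 1) (orderOf a : ℤ) := by
    obtain ⟨j, hj⟩ := hle (ha ▸ Subgroup.mem_zpowers a)
    simp only at hj
    rw [← zpow_mul, ← mul_inv_eq_one, ← zpow_sub_one,
      ← orderOf_dvd_iff_zpow_eq_one] at hj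
    obtain ⟨c, hc⟩ := hj
    exact ⟨j, -c, by linarith⟩
  have hapos := orderOf_pos a
  have hpow : ∀ j : ℕ, b⁻¹ ^ j * a * b ^ j = a ^ r ^ j := by
    intro j
    induction j with
    | zero => simp
    | succ j ih =>
      have h2 := conj_pow (i := r ^ j) (a := b⁻¹) (b := a)
      rw [inv_inv, hconj] at h2
      rw [pow_succ' b⁻¹, pow_succ b, pow_succ', pow_mul, h2, ← ih]
      group
  have hmod : r ^ orderOf b ≡ 1 [MOD orderOf a] := by
    have h2 := hpow (orderOf b)
    rw [inv_pow, pow_orderOf_eq_one, inv_one, one_mul, mul_one] at h2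
    nth_rw 1 [← pow_one a] at h2
    exact (pow_eq_pow_iff_modEq.1 h2).symm
  refine ⟨orderOf b, orderOf a, r, a, b, ⟨orderOf_pos b, ?_, Nat.mod_lt _ hapos, hmod, ?_⟩,
    pow_orderOf_eq_one a, pow_orderOf_eq_one b, hconj, hcl, hcard.symm⟩
  -- If the order of `a` were even, `r - 1` would be odd and `r` even, against `r ^ n ≡ 1` modulo
  -- `2`.
  · rw [← Nat.not_even_iff_odd]
    intro he
    have h2 : (2 : ℤ) ∣ orderOf a := Int.natCast_dvd_natCast.2 he.two_dvd
    have h3 : ¬ (2 : ℤ) ∣ (r : ℤ) - 1 := fun h => by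
      have := hra.isUnit_of_dvd' h h2
      norm_num [Int.isUnit_iff] at this
    have h4 : Even (r ^ orderOf b) := by
      rw [Nat.even_pow]
      exact ⟨by rw [Nat.even_iff]; omega, (orderOf_pos b).ne'⟩
    have h5 : r ^ orderOf b ≡ 1 [MOD 2] := hmod.of_dvd he.two_dvd
    rw [Nat.ModEq, Nat.even_iff.1 h4] at h5
    omega
  · rw [← Int.isCoprime_iff_gcd_eq_one]
    exact (Nat.isCoprime_iff_coprime.2 hcop).mul_right hra.symm

theorem isZGroup_iff_exists_isHolderParam {G : Type*} [Group G] [Finite G] : IsZGroup G ↔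
    ∃ n m r : ℕ, IsHolderParam n m r ∧ Nonempty (G ≃* HolderGroup n m r) := by
  constructor
  · intro hG
    obtain ⟨n, m, r, a, b, h⟩ := hG.exists_isHolderPair
    obtain ⟨e, -⟩ := h.exists_equiv
    exact ⟨n, m, r, h.param, ⟨e.symm⟩⟩
  · rintro ⟨n, m, r, hp, ⟨e⟩⟩
    obtain ⟨a, b, h⟩ := exists_isHolderPair_of_equiv hp e
    obtain ⟨p, hpa, hpb⟩ := h.exists_proj
    have hcop : (Nat.card (Subgroup.zpowers a)).Coprime (Nat.card (Multiplicative (ZMod n))) := by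
      have := NeZero.of_pos h.param.n_pos
      simpa [h.orderOf_a] using h.param.coprime
    refine isZGroup_of_coprime (f := (Subgroup.zpowers a).subtype) (f' := p) ?_ hcop
    intro g hg
    obtain ⟨i, j, rfl⟩ := h.exists_pow g
    rw [MonoidHom.mem_ker, map_mul, map_pow, map_pow, hpa, hpb, one_pow, mul_one, ← ofAdd_nsmul,
      ofAdd_eq_one, nsmul_one, ZMod.natCast_eq_zero_iff] at hg
    rw [Subgroup.range_subtype]
    exact mul_mem ((h.pow_b_mem_zpowers i).2 hg) (pow_mem (Subgroup.mem_zpowers a) j)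

/-! ### Central extensions of `G`. -/

theorem exists_zsmul_eq_of_isCoprime {A : Type*} [AddCommGroup A] {k l : ℤ} (hkl : IsCoprime k l)
    {u z : A} (h : k • u + l • z = 0) : ∃ s t : ℤ,
    k • (s • z + t • u) = z ∧ l • (s • z + t • u) = -u := by
  obtain ⟨s, t, hst⟩ := hkl
  -- The system `k v = z`, `l v = -u` is solved by `v = s z - t u`; the hypothesis is its
  -- compatibility condition `l z = -k u`.
  refine ⟨s, -t, ?_, ?_⟩
  · linear_combination (norm := skip) (-t) • h + hst • z
    module
  · linear_combination (norm := skip) s • h - hst • u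
    module

namespace IsHolderPair

variable {G E : Type*} [Group G] [Group E] {n m r : ℕ} {a b : G}

open scoped IsMulCommutative in
/-- The relations for `a` and its conjugate by `b` lift to central extensions. -/
theorem exists_lift_of_ker_le_center (h : IsHolderPair n m r a b) {p : E →* G}
    (hp : Function.Surjective p) (hc : p.ker ≤ Subgroup.center E) {y : E} (hy : p y = b) :
    ∃ x : E, p x = a ∧ x ^ m = 1 ∧ y⁻¹ * x * y = x ^ r := by
  obtain ⟨x, hx⟩ := hp a
  have hu : x ^ m ∈ Subgroup.center E := hc (by rw [MonoidHom.mem_ker, map_pow, hx, h.pow_a])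
  have hz : (x ^ r)⁻¹ * (y⁻¹ * x * y) ∈ Subgroup.center E := hc (by
    rw [MonoidHom.mem_ker, map_mul, map_mul, map_mul, map_inv, map_inv, map_pow, hx, hy, h.conj,
      inv_mul_cancel])
  set z : Subgroup.center E := ⟨_, hz⟩ with hzdef
  set u : Subgroup.center E := ⟨_, hu⟩ with hudef
  have hzc : ∀ (w : Subgroup.center E) (e : E), Commute (w : E) e := fun w e =>
    (Subgroup.mem_center_iff.1 w.2 e).symm
  have hxz : y⁻¹ * x * y = x ^ r * z := by simp [hzdef]
  -- Compare the `m`-th powers in `x^y = x^r z`, where `x^m = u` is central.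
  have huz : u ^ r * z ^ m = u := by
    ext
    have h1 : y⁻¹ * x ^ m * y = x ^ m := by
      rw [mul_assoc, show x ^ m * y = y * x ^ m from (hzc u y).eq, inv_mul_cancel_left]
    have h2 := _root_.conj_pow (i := m) (a := y⁻¹) (b := x)
    rw [inv_inv, h1, hxz, ((hzc z (x ^ r)).symm).mul_pow, ← pow_mul, mul_comm r, pow_mul] at h2
    simpa [hudef] using h2
  -- Replacing `x` by `x v` with `v` central repairs both relations when `v^(r-1) = z` and `v^m =
  -- u⁻¹`. As a product of powers of `z` and `u`, `v` lies in the kernel.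
  obtain ⟨s, t, hv1, hv2⟩ := exists_zsmul_eq_of_isCoprime (A := Additive (Subgroup.center E))
    (u := Additive.ofMul u) (z := Additive.ofMul z) h.param.isCoprime_sub_one (by
      have := congrArg Additive.ofMul huz
      rw [ofMul_mul, ofMul_pow, ofMul_pow] at this
      rw [sub_smul, natCast_zsmul, natCast_zsmul, one_zsmul, sub_add_eq_add_sub, this, sub_self])
  set v := s • Additive.ofMul z + t • Additive.ofMul u with hv
  have hpv : p (v.toMul : Subgroup.center E) = 1 := by
    have hpu : p u = 1 := by rw [hudef, map_pow, hx, h.pow_a]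
    have hpz : p z = 1 := by
      rw [hzdef, map_mul, map_mul, map_mul, map_inv, map_inv, map_pow, hx, hy, h.conj,
        inv_mul_cancel]
    have : ((v.toMul : Subgroup.center E) : E) = (z : E) ^ s * (u : E) ^ t := rfl
    rw [this, map_mul, map_zpow, map_zpow, hpz, hpu, one_zpow, one_zpow, mul_one]
  have hv1' : v.toMul ^ r = v.toMul * z := by
    rw [sub_smul, natCast_zsmul, one_zsmul, sub_eq_iff_eq_add] at hv1
    rw [mul_comm]
    exact hv1
  have hv2' : u * v.toMul ^ m = 1 := by
    rw [natCast_zsmul] at hv2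
    have : v.toMul ^ m = u⁻¹ := hv2
    rw [this, mul_inv_cancel]
  set w := v.toMul
  have hpw : ∀ k : ℕ, (x * w) ^ k = x ^ k * (w ^ k : Subgroup.center E) := fun k => by
    rw [(hzc w x).symm.mul_pow, Subgroup.coe_pow]
  have hxm : (x * w) ^ m = 1 := by
    rw [hpw]
    exact congrArg Subtype.val hv2'
  refine ⟨x * w, ?_, hxm, ?_⟩
  · rw [map_mul, hpv, hx, mul_one]
  · rw [hpw, hv1', ← mul_assoc, mul_assoc _ (w : E) y, (hzc w y).eq, ← mul_assoc, hxz,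
      Subgroup.coe_mul, (hzc w _).eq, mul_assoc]

variable (h : IsHolderPair n m r a b) {p : E →* G} (hp : Function.Surjective p)
  (hc : p.ker ≤ Subgroup.center E)
include h hp hc

/-- The commutator subgroup of a central extension intersects the kernel trivially. -/
theorem eq_one_of_mem_commutator_of_ker_le_center {e : E} (he : e ∈ commutator E)
    (hpe : p e = 1) : e = 1 := by
  obtain ⟨y, hy⟩ := hp b
  obtain ⟨x, hx, hxm, hxy⟩ := h.exists_lift_of_ker_le_center hp hc hy
  have hdecomp : ∀ e : E, ∃ z ∈ Subgroup.center E, ∃ i j : ℕ, e = z * (y ^ i * x ^ j) := by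
    intro e
    obtain ⟨i, j, hij⟩ := h.exists_pow (p e)
    refine ⟨e * (y ^ i * x ^ j)⁻¹, hc ?_, i, j, (inv_mul_cancel_right _ _).symm⟩
    rw [MonoidHom.mem_ker, map_mul, map_inv, map_mul, map_pow, map_pow, hx, hy, hij,
      mul_inv_cancel]
  have hconj : ∀ i : ℕ, (y ^ i)⁻¹ * x * y ^ i = x ^ r ^ i := by
    intro i
    induction i with
    | zero => simp
    | succ i ih =>
      have h2 := _root_.conj_pow (i := r ^ i) (a := y⁻¹) (b := x)
      rw [inv_inv, hxy] at h2
      rw [pow_succ y, pow_succ', pow_mul, h2, ← ih]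
      group
  -- `E` is generated by its center, `y` and `x`, and conjugation by `y` takes `x` to `x^r`. So
  -- `⟨x⟩` is normal with abelian quotient and contains the commutator subgroup.
  have hnormal : (Subgroup.zpowers x).Normal := by
    have h1 : ∀ e : E, e⁻¹ * x * e ∈ Subgroup.zpowers x := by
      intro e
      obtain ⟨z, hz, i, j, rfl⟩ := hdecomp e
      have h2 : (z * (y ^ i * x ^ j))⁻¹ * x * (z * (y ^ i * x ^ j)) =
          (x ^ j)⁻¹ * ((y ^ i)⁻¹ * x * y ^ i) * x ^ j := by
        rw [mul_inv_rev, mul_assoc _ z⁻¹ x, mul_assoc _ (z⁻¹ * x),  mul_assoc z⁻¹ x,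
          ← mul_assoc x z, Subgroup.mem_center_iff.1 hz x, mul_assoc z, inv_mul_cancel_left]
        group
      rw [h2, hconj]
      exact mul_mem (mul_mem (inv_mem (pow_mem (Subgroup.mem_zpowers x) _))
        (pow_mem (Subgroup.mem_zpowers x) _)) (pow_mem (Subgroup.mem_zpowers x) _)
    refine ⟨fun w hw g => ?_⟩
    obtain ⟨k, rfl⟩ := hw
    simp only
    rw [← conj_zpow]
    have := h1 g⁻¹
    rw [inv_inv] at this
    exact zpow_mem this k
  have hle : commutator E ≤ Subgroup.zpowers x := by
    refine commutator_le_of_closure_eq_top (S := Set.univ) (by simp) fun s _ t _ => ?_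
    obtain ⟨z, hz, i, j, rfl⟩ := hdecomp s
    obtain ⟨z', hz', i', j', rfl⟩ := hdecomp t
    have hx1 : (x : E ⧸ Subgroup.zpowers x) = 1 :=
      (QuotientGroup.eq_one_iff _).2 (Subgroup.mem_zpowers x)
    have hcen : ∀ z ∈ Subgroup.center E, ∀ e : E,
        Commute (z : E ⧸ Subgroup.zpowers x) (e : E ⧸ Subgroup.zpowers x) := fun z hz e =>
      (congrArg QuotientGroup.mk (Subgroup.mem_center_iff.1 hz e)).symm
    simp only [QuotientGroup.mk_mul, QuotientGroup.mk_pow, hx1, one_pow, mul_one]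
    refine Commute.mul_left ?_ (Commute.mul_right ?_ ?_)
    · exact_mod_cast hcen z hz (z' * y ^ i')
    · exact_mod_cast (hcen z' hz' (y ^ i)).symm
    · exact (Commute.refl _).pow_pow _ _
  -- `p` is injective on `⟨x⟩`, since `x ^ m = 1` and `p x = a` has order `m`.
  obtain ⟨k, rfl⟩ := hle he
  have h1 : a ^ k = 1 := by rw [← hx, ← map_zpow]; exact hpe
  rw [← orderOf_dvd_iff_zpow_eq_one, h.orderOf_a] at h1
  obtain ⟨l, rfl⟩ := h1
  simp [zpow_mul, hxm]

/-- A central extension whose kernel is closed under `n`-th roots splits. -/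
theorem exists_section_of_ker_le_center
    (hdiv : ∀ z ∈ p.ker, ∃ w ∈ p.ker, w ^ n = z) : ∃ σ : G →* E, ∀ g, p (σ g) = g := by
  obtain ⟨y, hy⟩ := hp b
  obtain ⟨w, hw, hwn⟩ := hdiv (y ^ n)⁻¹ (by
    rw [MonoidHom.mem_ker, map_inv, map_pow, hy, h.pow_b, inv_one])
  have hyw : p (y * w) = b := by rw [map_mul, MonoidHom.mem_ker.1 hw, mul_one, hy]
  have hn : (y * w) ^ n = 1 := by
    have hcomm : Commute y w := Subgroup.mem_center_iff.1 (hc hw) y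
    rw [hcomm.mul_pow, hwn, mul_inv_cancel]
  obtain ⟨x, hx, hxm, hxy⟩ := h.exists_lift_of_ker_le_center hp hc hyw
  obtain ⟨σ, hσa, hσb⟩ := h.exists_hom hxm hn hxy
  have : p.comp σ = MonoidHom.id G := h.ext_hom (by simp [hσa, hx]) (by simp [hσb, hyw])
  exact ⟨σ, DFunLike.congr_fun this⟩

end IsHolderPair

/-! ### Extensions from cocycles and the Schur multiplier. -/

/-- The extension of `G` by `A` defined by a `2`-cocycle for the trivial action. -/
@[ext] structure CocycleExtension {G A : Type*} [Group G] [AddCommGroup A] (f : G × G → A)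
    (hf : ∀ g h j, f (g * h, j) + f (g, h) = f (h, j) + f (g, h * j)) where
  /-- The component in `G`. -/
  fst : G
  /-- The component in `A`. -/
  snd : A

namespace CocycleExtension

variable {G A : Type*} [Group G] [AddCommGroup A] {f : G × G → A}
  {hf : ∀ g h j, f (g * h, j) + f (g, h) = f (h, j) + f (g, h * j)}

theorem cocycle_one_left (hf : ∀ g h j, f (g * h, j) + f (g, h) = f (h, j) + f (g, h * j)) (g : G) :
    f (1, g) = f (1, 1) := by
  simpa using (hf 1 1 g).symm

theorem cocycle_one_right (hf : ∀ g h j, f (g * h, j) + f (g, h) = f (h, j) + f (g, h * j))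
    (g : G) : f (g, 1) = f (1, 1) := by
  simpa using hf g 1 1

instance : Mul (CocycleExtension f hf) :=
  ⟨fun x y => ⟨x.fst * y.fst, x.snd + y.snd + f (x.fst, y.fst)⟩⟩

/-- The cocycle is not assumed normalized, so the neutral element absorbs the constant `f (1, g) = f
(g, 1) = f (1, 1)`. -/
instance : One (CocycleExtension f hf) := ⟨⟨1, -f (1, 1)⟩⟩

instance : Inv (CocycleExtension f hf) :=
  ⟨fun x => ⟨x.fst⁻¹, -x.snd - f (x.fst⁻¹, x.fst) - f (1, 1)⟩⟩

@[simp] theorem fst_mul (x y : CocycleExtension f hf) : (x * y).fst = x.fst * y.fst := rfl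

@[simp] theorem snd_mul (x y : CocycleExtension f hf) :
    (x * y).snd = x.snd + y.snd + f (x.fst, y.fst) := rfl

@[simp] theorem fst_one : (1 : CocycleExtension f hf).fst = 1 := rfl

@[simp] theorem snd_one : (1 : CocycleExtension f hf).snd = -f (1, 1) := rfl

@[simp] theorem fst_inv (x : CocycleExtension f hf) : x⁻¹.fst = x.fst⁻¹ := rfl

@[simp] theorem snd_inv (x : CocycleExtension f hf) :
    x⁻¹.snd = -x.snd - f (x.fst⁻¹, x.fst) - f (1, 1) := rfl

instance : Group (CocycleExtension f hf) :=
  Group.ofLeftAxioms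
    (fun x y z => by
      ext
      · simp [mul_assoc]
      · have := hf x.fst y.fst z.fst
        simp only [snd_mul, fst_mul]
        linear_combination (norm := skip) this
        abel)
    (fun x => by
      ext
      · simp
      · simp [cocycle_one_left hf x.fst])
    (fun x => by
      ext
      · simp
      · simp only [snd_mul, snd_inv, fst_inv, snd_one]
        abel)

/-- The projection of the extension onto `G`. -/
def proj : CocycleExtension f hf →* G where
  toFun := fst
  map_one' := rfl
  map_mul' _ _ := rfl

theorem proj_surjective : Function.Surjective (proj (f := f) (hf := hf)) := fun g => ⟨⟨g, 0⟩, rfl⟩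

theorem ker_proj_le_center : (proj (f := f) (hf := hf)).ker ≤ Subgroup.center _ := by
  rintro ⟨g, u⟩ (rfl : g = 1)
  rw [Subgroup.mem_center_iff]
  intro x
  ext
  · simp
  · simp [cocycle_one_left hf x.fst, cocycle_one_right hf x.fst, add_comm]

/-- The shifted map `u ↦ (1, u - f (1, 1))` identifies `A` with the kernel, so roots are inherited
from `A`. -/
theorem exists_pow_eq_of_mem_ker (n : ℕ) (hdiv : ∀ u : A, ∃ v : A, n • v = u)
    (z : CocycleExtension f hf) (hz : z ∈ proj.ker) : ∃ w ∈ proj.ker, w ^ n = z := by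
  obtain ⟨g, u⟩ := z
  obtain rfl : g = 1 := hz
  obtain ⟨v, hv⟩ := hdiv (u + f (1, 1))
  have hpow : ∀ k : ℕ, (⟨1, v - f (1, 1)⟩ : CocycleExtension f hf) ^ k = ⟨1, k • v - f (1, 1)⟩ := by
    intro k
    induction k with
    | zero => ext <;> simp
    | succ k ih =>
      rw [pow_succ, ih]
      ext
      · simp
      · simp only [snd_mul, succ_nsmul]
        abel
  exact ⟨⟨1, v - f (1, 1)⟩, rfl, by rw [hpow, hv, add_sub_cancel_right]⟩

end CocycleExtension

universe u in
/-- The Schur multiplier of a finite Z-group is trivial. -/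
theorem IsHolderPair.subsingleton_schurMultiplier {G : Type u} [Group G] {n m r : ℕ} {a b : G}
    (h : IsHolderPair n m r a b) : Subsingleton (SchurMultiplier G) := by
  suffices h0 : ∀ x : SchurMultiplier G, x = 0 from ⟨fun x y => (h0 x).trans (h0 y).symm⟩
  intro x
  induction x using groupCohomology.H2_induction_on with
  | h f =>
    rw [groupCohomology.H2π_eq_zero_iff]
    have hf := (groupCohomology.mem_cocycles₂_iff _).1 f.2
    have hf' : ∀ g h j : G, f (g * h, j) + f (g, h) = f (h, j) + f (g, h * j) := hf
    have hdiv : ∀ u : ULift.{u} (Additive ℂˣ), ∃ v : ULift.{u} (Additive ℂˣ), n • v = u := by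
      rintro ⟨u⟩
      obtain ⟨v, hv⟩ := IsAlgClosed.exists_pow_nat_eq (u.toMul : ℂ) h.param.n_pos
      have hv0 : v ≠ 0 := by
        rintro rfl
        rw [zero_pow h.param.n_pos.ne'] at hv
        exact u.toMul.ne_zero hv.symm
      refine ⟨⟨Additive.ofMul (Units.mk0 v hv0)⟩, ?_⟩
      ext
      exact hv
    obtain ⟨σ, hσ⟩ := h.exists_section_of_ker_le_center
      (CocycleExtension.proj_surjective (f := f) (hf := hf'))
      CocycleExtension.ker_proj_le_center
      (CocycleExtension.exists_pow_eq_of_mem_ker n hdiv)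
    -- Second components of `σ (g k) = σ g * σ k` exhibit `f` as the coboundary of `-(σ ·).snd`.
    refine ⟨fun g => -(σ g).snd, funext fun ⟨g, k⟩ => ?_⟩
    have h1 := congrArg CocycleExtension.snd (σ.map_mul g k)
    have h2 : (σ g).fst = g := hσ g
    have h3 : (σ k).fst = k := hσ k
    rw [CocycleExtension.snd_mul, h2, h3] at h1
    change -(σ k).snd - -(σ (g * k)).snd + -(σ g).snd = f (g, k)
    rw [h1]
    abel

/-! ### Hopf's formula and the isomorphism of `K̃(G,3)` with `K(G,3)`. -/

/-- Hopf's formula for a Z-group, whose Schur multiplier is trivial. -/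
theorem IsHolderPair.mem_commutator_ker_top {G F : Type*} [Group G] [Group F] {n m r : ℕ} {a b : G}
    (h : IsHolderPair n m r a b) {π : F →* G} (hπ : Function.Surjective π) {c : F}
    (hc : c ∈ commutator F) (hker : π c = 1) : c ∈ ⁅π.ker, (⊤ : Subgroup F)⁆ := by
  have hle : ⁅π.ker, (⊤ : Subgroup F)⁆ ≤ π.ker := Subgroup.commutator_le_left _ _
  let p : F ⧸ ⁅π.ker, (⊤ : Subgroup F)⁆ →* G := QuotientGroup.lift _ π hle
  have hp : Function.Surjective p := fun g =>
    (hπ g).elim fun f hf => ⟨(f : F ⧸ ⁅π.ker, (⊤ : Subgroup F)⁆), hf⟩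
  have hcen : p.ker ≤ Subgroup.center _ := by
    intro x hx
    induction x using QuotientGroup.induction_on with
    | H x =>
    rw [Subgroup.mem_center_iff]
    intro y
    induction y using QuotientGroup.induction_on with
    | H y =>
    have hx' : x ∈ π.ker := hx
    have := (QuotientGroup.eq_one_iff _).2
      (Subgroup.commutator_mem_commutator hx' (Subgroup.mem_top y))
    exact (commutatorElement_eq_one_iff_mul_comm.1 this).symm
  rw [← QuotientGroup.eq_one_iff]
  refine h.eq_one_of_mem_commutator_of_ker_le_center hp hcen ?_ hker
  have := Subgroup.mem_map_of_mem (QuotientGroup.mk' ⁅π.ker, (⊤ : Subgroup F)⁆) hc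
  rw [commutator_def, Subgroup.map_commutator] at this
  rw [commutator_def]
  exact Subgroup.commutator_mono le_top le_top this

theorem mem_liedtkeK_three {G : Type*} [Group G] (g : Fin 3 → G) :
    g ∈ liedtkeK G 3 ↔ g 0 * g 1 * g 2 ∈ commutator G := by
  rw [mem_liedtkeK]
  simp [List.ofFn_succ, mul_assoc]

section relK

variable {F G : Type*} [Group F] [Group G] (π : F →* G)

theorem mem_relK_of_mul_eq_one {x : Fin 3 → F} (hx : ∀ i, π (x i) = 1)
    (hprod : x 0 * x 1 * x 2 = 1) : x ∈ relK π 3 := by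
  refine Subgroup.subset_normalClosure ⟨fun i => ⟨x i, hx i⟩, ?_, rfl⟩
  rw [SetLike.mem_coe, mem_liedtkeK_three]
  have h1 : (fun i => (⟨x i, hx i⟩ : π.ker)) 0 * (fun i => (⟨x i, hx i⟩ : π.ker)) 1 *
      (fun i => (⟨x i, hx i⟩ : π.ker)) 2 = 1 := Subtype.ext hprod
  rw [h1]
  exact one_mem _

/-- Multiplying `(k, k⁻¹, 1)` by the conjugate of its inverse under `(f, 1, 1)` cancels the second
entry and leaves a commutator of `k` and `f` in the first. -/
theorem single_mem_relK {c : F} (hc : c ∈ ⁅π.ker, (⊤ : Subgroup F)⁆) :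
    (![c, 1, 1] : Fin 3 → F) ∈ relK π 3 := by
  have hle : ⁅π.ker, (⊤ : Subgroup F)⁆ ≤ (relK π 3).comap (MonoidHom.mulSingle (fun _ => F) 0) := by
    rw [Subgroup.commutator_le]
    intro k hk f _
    have h1 : (![k, k⁻¹, 1] : Fin 3 → F) ∈ relK π 3 :=
      mem_relK_of_mul_eq_one π (by simp [Fin.forall_fin_succ, MonoidHom.mem_ker.1 hk]) (by simp)
    have h2 := (relK_normal π 3).conj_mem _ (inv_mem h1) ![f, 1, 1]
    have h3 := mul_mem h1 h2
    rw [Subgroup.mem_comap]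
    convert h3 using 1
    funext i
    fin_cases i <;> simp [commutatorElement_def, mul_assoc]
  have := hle hc
  rw [Subgroup.mem_comap] at this
  convert this using 1
  funext i
  fin_cases i <;> simp

theorem mem_relK_three {x : Fin 3 → F} (hx : ∀ i, π (x i) = 1)
    (hprod : x 0 * x 1 * x 2 ∈ ⁅π.ker, (⊤ : Subgroup F)⁆) : x ∈ relK π 3 := by
  have h1 : (![(x 1 * x 2)⁻¹, x 1, x 2] : Fin 3 → F) ∈ relK π 3 :=
    mem_relK_of_mul_eq_one π (by simp [Fin.forall_fin_succ, hx]) (by simp)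
  convert mul_mem (single_mem_relK π hprod) h1 using 1
  funext i
  fin_cases i <;> simp [mul_assoc]

end relK

/-- A kernel element is a triple in `N³` with product in `F' ∩ N = [N,F]`, and such triples lie in
`relK`. For surjectivity, lift two entries freely and choose the third so that the product is in
`F'`. -/
theorem IsHolderPair.bijective_toK {G F : Type*} [Group G] [Group F] {n m r : ℕ} {a b : G}
    (h : IsHolderPair n m r a b) {π : F →* G} (hπ : Function.Surjective π) :
    Function.Bijective (KTilde.toK π 3) := by
  constructor
  · rw [injective_iff_map_eq_one]
    intro x hx
    induction x using QuotientGroup.induction_on with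
    | H x =>
    rw [QuotientGroup.eq_one_iff, Subgroup.mem_subgroupOf]
    have hx' : ∀ i, π ((x : Fin 3 → F) i) = 1 := fun i =>
      congrFun (congrArg Subtype.val hx) i
    refine mem_relK_three π hx' (h.mem_commutator_ker_top hπ ((mem_liedtkeK_three _).1 x.2) ?_)
    simp [hx']
  · rintro ⟨g, hg⟩
    rw [mem_liedtkeK_three] at hg
    have hmap : (commutator F).map π = commutator G := by
      rw [commutator_def, Subgroup.map_commutator, Subgroup.map_top_of_surjective π hπ,
        ← commutator_def]
    rw [← hmap] at hg
    obtain ⟨c, hc, hcg⟩ := hg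
    obtain ⟨x, hx⟩ := hπ (g 0)
    obtain ⟨y, hy⟩ := hπ (g 1)
    refine ⟨QuotientGroup.mk ⟨![x, y, (x * y)⁻¹ * c], ?_⟩, ?_⟩
    · rw [mem_liedtkeK_three]
      simpa [mul_assoc] using hc
    · apply Subtype.ext
      funext i
      change π (![x, y, (x * y)⁻¹ * c] i) = g i
      fin_cases i
      · exact hx
      · exact hy
      · change π ((x * y)⁻¹ * c) = g 2
        rw [map_mul, map_inv, map_mul, hx, hy, hcg]
        group

/-! ### The group `τ(G)` and its image in `G³`. -/

section Tau

variable (G : Type*) [Group G]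

/-- The map `G → τ(G)`, `g ↦ g`. -/
def Tau.left : G →* Tau G := (QuotientGroup.mk' (nabla G)).comp (Nu.left G)

/-- The map `G → τ(G)`, `g ↦ g*`. -/
def Tau.right : G →* Tau G := (QuotientGroup.mk' (nabla G)).comp (Nu.right G)

theorem Tau.rconj_left (x y z : G) :
    rconj (rcomm (left G x) (right G y)) (left G z) =
      rcomm (left G (rconj x z)) (right G (rconj y z)) :=
  congrArg (QuotientGroup.mk' (nabla G)) (Nu.rconj_left G x y z)

theorem Tau.rconj_right (x y z : G) :
    rconj (rcomm (left G x) (right G y)) (right G z) =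
      rcomm (left G (rconj x z)) (right G (rconj y z)) :=
  congrArg (QuotientGroup.mk' (nabla G)) (Nu.rconj_right G x y z)

theorem Tau.rcomm_self (x : G) : rcomm (left G x) (right G x) = 1 :=
  (QuotientGroup.eq_one_iff _).2 (Subgroup.subset_closure ⟨x, rfl⟩)

theorem Tau.commute_self (x : G) : Commute (left G x) (right G x) := by
  have h := rcomm_self G x
  have h1 : left G x * right G x =
      right G x * left G x * rcomm (left G x) (right G x) := by
    simp only [rcomm]; group
  rwa [h, mul_one] at h1

theorem Tau.closure_eq : Subgroup.closure (Set.range (left G) ∪ Set.range (right G)) = ⊤ := by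
  rw [eq_top_iff]
  intro t ht
  clear ht
  induction t using QuotientGroup.induction_on with
  | H t =>
  induction t using QuotientGroup.induction_on with
  | H t =>
  induction t using Monoid.Coprod.induction_on with
  | inl x => exact Subgroup.subset_closure (Or.inl ⟨x, rfl⟩)
  | inr x => exact Subgroup.subset_closure (Or.inr ⟨x, rfl⟩)
  | mul x y hx hy => exact mul_mem hx hy

variable {G}

/-- The universal property of `τ(G)`. -/
theorem Tau.exists_hom {H : Type*} [Group H] (f g : G →* H)
    (h1 : ∀ x y z, rconj (rcomm (f x) (g y)) (f z) = rcomm (f (rconj x z)) (g (rconj y z)))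
    (h2 : ∀ x y z, rconj (rcomm (f x) (g y)) (g z) = rcomm (f (rconj x z)) (g (rconj y z)))
    (h3 : ∀ x, rcomm (f x) (g x) = 1) :
    ∃ φ : Tau G →* H, (∀ x, φ (left G x) = f x) ∧ ∀ x, φ (right G x) = g x := by
  let φ₀ : Monoid.Coprod G G →* H := Monoid.Coprod.lift f g
  have hφ₀ : Subgroup.normalClosure (nuRels G) ≤ φ₀.ker := by
    refine Subgroup.normalClosure_le_normal ?_
    rintro w ⟨x, y, z, rfl | rfl⟩
    · rw [SetLike.mem_coe, MonoidHom.mem_ker, map_mul, map_inv, mul_inv_eq_one]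
      simpa [rconj, rcomm, φ₀] using h1 x y z
    · rw [SetLike.mem_coe, MonoidHom.mem_ker, map_mul, map_inv, mul_inv_eq_one]
      simpa [rconj, rcomm, φ₀] using h2 x y z
  let φ₁ : Nu G →* H := QuotientGroup.lift _ φ₀ hφ₀
  have hl : ∀ x, φ₁ (Nu.left G x) = f x := fun x => Monoid.Coprod.lift_apply_inl f g x
  have hr : ∀ x, φ₁ (Nu.right G x) = g x := fun x => Monoid.Coprod.lift_apply_inr f g x
  have hφ₁ : nabla G ≤ φ₁.ker := by
    rw [nabla, Subgroup.closure_le]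
    rintro _ ⟨x, rfl⟩
    rw [SetLike.mem_coe, MonoidHom.mem_ker, ← h3 x, ← hl, ← hr]
    simp [rcomm]
  exact ⟨QuotientGroup.lift _ φ₁ hφ₁, hl, hr⟩

variable (G)

/-- The homomorphism `τ(G) → G³` with `g ↦ (g, 1, g)` and `g* ↦ (1, g, g)`. -/
theorem Tau.exists_toTriple : ∃ φ : Tau G →* (Fin 3 → G),
    (∀ x, φ (left G x) = ![x, 1, x]) ∧ ∀ x, φ (right G x) = ![1, x, x] := by
  have hmul : ∀ x y z x' y' z' : G,
      (![x, y, z] * ![x', y', z'] : Fin 3 → G) = ![x * x', y * y', z * z'] := by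
    intros; funext i; fin_cases i <;> rfl
  let f : G →* (Fin 3 → G) := ⟨⟨fun x => ![x, 1, x], by funext i; fin_cases i <;> rfl⟩,
    fun x y => by simp [hmul]⟩
  let g : G →* (Fin 3 → G) := ⟨⟨fun x => ![1, x, x], by funext i; fin_cases i <;> rfl⟩,
    fun x y => by simp [hmul]⟩
  refine Tau.exists_hom f g ?_ ?_ ?_
  · intro x y z
    funext i
    fin_cases i <;> simp [f, g, rconj, rcomm, mul_assoc]
  · intro x y z
    funext i
    fin_cases i <;> simp [f, g, rconj, rcomm, mul_assoc]
  · intro x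
    funext i
    fin_cases i <;> simp [f, g, rcomm]

/-- The image of `τ(G)` in `G³`. -/
def tauImage : Subgroup (Fin 3 → G) where
  carrier := {x | Abelianization.of (x 0) * .of (x 1) = .of (x 2)}
  one_mem' := by simp
  mul_mem' := by
    intro x y hx hy
    simp only [Set.mem_ofPred_eq, Pi.mul_apply, map_mul] at hx hy ⊢
    rw [← hx, ← hy, mul_mul_mul_comm]
  inv_mem' := by
    intro x hx
    simp only [Set.mem_ofPred_eq, Pi.inv_apply, map_inv] at hx ⊢
    rw [← hx, mul_inv]

variable {G}

theorem mem_tauImage (x : Fin 3 → G) :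
    x ∈ tauImage G ↔ Abelianization.of (x 0) * .of (x 1) = Abelianization.of (x 2) := Iff.rfl

/-- A commutator of `y` and `z*` maps to one of `y` and `z` in the third coordinate only, so that
coordinate can be varied freely within `G'`. -/
theorem Tau.range_eq_tauImage {φ : Tau G →* (Fin 3 → G)} (hl : ∀ x, φ (left G x) = ![x, 1, x])
    (hr : ∀ x, φ (right G x) = ![1, x, x]) : φ.range = tauImage G := by
  apply le_antisymm
  · rw [MonoidHom.range_eq_map, ← Tau.closure_eq, MonoidHom.map_closure, Subgroup.closure_le]
    rintro _ ⟨_, ⟨x, rfl⟩ | ⟨x, rfl⟩, rfl⟩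
    · simp [hl, mem_tauImage]
    · simp [hr, mem_tauImage]
  · intro x hx
    have hcomm : commutator G ≤ φ.range.comap (MonoidHom.mulSingle (fun _ => G) 2) := by
      rw [commutator_def, Subgroup.commutator_le]
      intro y _ z _
      refine ⟨left G y * right G z * (left G y)⁻¹ * (right G z)⁻¹, ?_⟩
      simp only [map_mul, map_inv, hl, hr]
      funext i
      fin_cases i <;> simp [commutatorElement_def]
    have h1 : (x 0 * x 1)⁻¹ * x 2 ∈ commutator G := by
      rw [← Abelianization.ker_of, MonoidHom.mem_ker, map_mul, map_inv, map_mul,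
        (mem_tauImage x).1 hx, inv_mul_cancel]
    obtain ⟨t, ht⟩ := hcomm h1
    refine ⟨left G (x 0) * right G (x 1) * t, ?_⟩
    rw [map_mul, map_mul, hl, hr, ht]
    funext i
    fin_cases i <;> simp [mul_assoc]

end Tau

/-- A cyclic subgroup is normal if its generator is conjugated into it by the elements of a
generating set and their inverses. -/
theorem zpowers_normal_of_closure_eq_top {T : Type*} [Group T] {S : Set T} {w : T}
    (hS : Subgroup.closure S = ⊤)
    (h : ∀ s ∈ S, s⁻¹ * w * s ∈ Subgroup.zpowers w ∧ s * w * s⁻¹ ∈ Subgroup.zpowers w) :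
    (Subgroup.zpowers w).Normal := by
  have key : ∀ s : T, s * w * s⁻¹ ∈ Subgroup.zpowers w →
      ∀ v ∈ Subgroup.zpowers w, s * v * s⁻¹ ∈ Subgroup.zpowers w := by
    rintro s hs _ ⟨k, rfl⟩
    simp only
    rw [← conj_zpow]
    exact zpow_mem hs k
  have all : ∀ t : T, (∀ v ∈ Subgroup.zpowers w, t⁻¹ * v * t ∈ Subgroup.zpowers w) ∧
      ∀ v ∈ Subgroup.zpowers w, t * v * t⁻¹ ∈ Subgroup.zpowers w := by
    intro t
    have ht : t ∈ Subgroup.closure S := hS ▸ Subgroup.mem_top t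
    induction ht using Subgroup.closure_induction with
    | mem s hs =>
      refine ⟨fun v hv => ?_, key s (h s hs).2⟩
      have := key s⁻¹ (by rw [inv_inv]; exact (h s hs).1) v hv
      rwa [inv_inv] at this
    | one => simp
    | mul x y _ _ hx hy =>
      refine ⟨fun v hv => ?_, fun v hv => ?_⟩
      · simpa [mul_assoc] using hy.1 _ (hx.1 v hv)
      · simpa [mul_assoc] using hx.2 _ (hy.2 v hv)
    | inv x _ hx =>
      rw [inv_inv]
      exact hx.symm
  exact ⟨fun v hv t => (all t).2 v hv⟩

namespace IsHolderPair

variable {G : Type*} [Group G] {n m r : ℕ} {a b : G}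

open Tau

/-- The commutator `[a, b*]` in `τ(G)` commutes with `a`. -/
theorem tau_commute_left (h : IsHolderPair n m r a b) :
    Commute (rcomm (left G a) (right G b)) (left G a) := by
  set w := rcomm (left G a) (right G b) with hw
  -- Conjugating `w = [a, b*]` by `a` gives `[a, (b a^(1-r))*]`. As `a` commutes with `(a^(1-r))*`,
  -- this is `w` conjugated by `(a^(1-r))*`, equivalently by `a^(1-r)`. Thus `w` commutes with
  -- `a^r`, and `r` is a unit modulo `m`.
  have h1 : rconj w (left G a) = rconj w (left G (a ^ (1 - r : ℤ))) := by
    have h2 : rconj b a = b * a ^ (1 - r : ℤ) := by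
      have h3 : b⁻¹ * a⁻¹ * b = (a ^ r)⁻¹ := by rw [← h.conj]; group
      rw [rconj, sub_eq_neg_add, zpow_add, zpow_neg, zpow_natCast, ← h3]
      group
    have h4 : rconj a a = a := by rw [rconj]; group
    have h5 : Commute (left G a) (right G (a ^ (1 - r : ℤ))) := by
      rw [map_zpow]
      exact (commute_self G a).zpow_right _
    rw [hw, rconj_left, h2, h4, rconj_left, ← rconj_right, rcomm, map_mul, rconj, rcomm]
    have h6 := h5.inv_inv.eq
    calc _ = ((left G a)⁻¹ * (right G (a ^ (1 - r : ℤ)))⁻¹) * (right G b)⁻¹ * left G a *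
          (right G b * right G (a ^ (1 - r : ℤ))) := by group
      _ = _ := by rw [h6]; group
  have h7 : Commute w (left G a ^ r) := by
    have h8 : left G a ^ r = left G a * (left G (a ^ (1 - r : ℤ)))⁻¹ := by
      rw [← map_inv, ← map_mul, ← map_pow, ← zpow_neg, ← zpow_one_add]
      congr 1
      rw [← zpow_natCast]
      congr 1
      ring
    rw [h8]
    set c := left G a
    set d := left G (a ^ (1 - r : ℤ))
    have h9 : w = c * rconj w d * c⁻¹ := by
      rw [← h1, rconj]; group
    change w * (c * d⁻¹) = c * d⁻¹ * w
    nth_rw 1 [h9]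
    rw [rconj]
    group
  have hm : left G a ^ m = 1 := by rw [← map_pow, h.pow_a, map_one]
  obtain ⟨s, t, hst⟩ := Nat.isCoprime_iff_coprime.2 h.param.coprime_r
  have h10 : left G a = (left G a ^ r) ^ s := by
    rw [← zpow_natCast, ← zpow_mul, show (r : ℤ) * s = 1 - m * t by linarith, zpow_sub, zpow_one,
      zpow_mul, zpow_natCast, hm]
    simp
  rw [h10]
  exact h7.zpow_right s

/-- Conjugation by `b*` takes `a` to `a w` with `w = [a, b*]`; since `a` and `w` commute, it takes
`a^k` to `a^k w^k`. -/
theorem tau_left_pow (h : IsHolderPair n m r a b) (k : ℕ) :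
    rcomm (left G (a ^ k)) (right G b) = rcomm (left G a) (right G b) ^ k := by
  have h1 : (right G b)⁻¹ * left G a * right G b =
      left G a * rcomm (left G a) (right G b) := by rw [rcomm]; group
  have h2 := _root_.conj_pow (i := k) (a := (right G b)⁻¹) (b := left G a)
  rw [inv_inv, h1, h.tau_commute_left.symm.mul_pow] at h2
  rw [rcomm, mul_assoc, mul_assoc, ← mul_assoc (right G b)⁻¹, map_pow, ← h2, inv_mul_cancel_left]

theorem tau_pow_eq_one (h : IsHolderPair n m r a b) :
    rcomm (left G a) (right G b) ^ m = 1 := by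
  rw [← h.tau_left_pow, h.pow_a]
  simp [rcomm]

/-- Conjugation by `b` turns `[a, b*]` into `[a^r, b*]`, its `r`-th power, and `a` centralizes it.
-/
theorem tau_rconj_left_mem (h : IsHolderPair n m r a b) (g : G) :
    rconj (rcomm (left G a) (right G b)) (left G g) ∈
      Subgroup.zpowers (rcomm (left G a) (right G b)) := by
  obtain ⟨i, j, rfl⟩ := h.exists_pow g
  have hb : ∀ i : ℕ, rconj (rcomm (left G a) (right G b)) (left G (b ^ i)) =
      rcomm (left G a) (right G b) ^ r ^ i := by
    intro i
    induction i with
    | zero => simp [rconj]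
    | succ i ih =>
      have h1 : rconj (rcomm (left G a) (right G b)) (left G b) =
          rcomm (left G a) (right G b) ^ r := by
        rw [rconj_left, rconj, h.conj, show rconj b b = b by rw [rconj]; group, h.tau_left_pow]
      have h2 := _root_.conj_pow (i := r ^ i) (a := (left G b)⁻¹)
        (b := rcomm (left G a) (right G b))
      rw [inv_inv] at h2
      rw [rconj] at h1 ih ⊢
      rw [h1, ← ih] at h2
      rw [pow_succ' r, pow_mul, h2, pow_succ b, map_mul]
      group
  have h1 : rconj (rcomm (left G a) (right G b)) (left G (b ^ i * a ^ j)) =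
      (left G a ^ j)⁻¹ * rconj (rcomm (left G a) (right G b)) (left G (b ^ i)) *
        left G a ^ j := by
    simp only [rconj, map_mul, map_pow, mul_inv_rev, mul_assoc]
  rw [h1, hb, mul_assoc, (h.tau_commute_left.pow_pow _ _).eq, inv_mul_cancel_left]
  exact pow_mem (Subgroup.mem_zpowers _) _

theorem tau_normal (h : IsHolderPair n m r a b) :
    (Subgroup.zpowers (rcomm (left G a) (right G b))).Normal := by
  have hright : ∀ g : G, rconj (rcomm (left G a) (right G b)) (right G g) ∈
      Subgroup.zpowers (rcomm (left G a) (right G b)) := by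
    intro g
    rw [rconj_right, ← rconj_left]
    exact h.tau_rconj_left_mem g
  refine zpowers_normal_of_closure_eq_top (Tau.closure_eq G) ?_
  rintro _ (⟨g, rfl⟩ | ⟨g, rfl⟩)
  · refine ⟨h.tau_rconj_left_mem g, ?_⟩
    have := h.tau_rconj_left_mem g⁻¹
    rwa [rconj, map_inv, inv_inv] at this
  · refine ⟨hright g, ?_⟩
    have := hright g⁻¹
    rwa [rconj, map_inv, inv_inv] at this

/-- Modulo `⟨[a, b*]⟩` the two copies of `G` in `τ(G)` commute. -/
theorem tau_commute_mod (h : IsHolderPair n m r a b) {N : Subgroup (Tau G)} [N.Normal]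
    (hN : rcomm (left G a) (right G b) ∈ N) (x y : G) :
    Commute ((left G x : Tau G) : Tau G ⧸ N) (right G y : Tau G) := by
  set q := QuotientGroup.mk' N with hq
  have hab : Commute (q (left G a)) (q (right G b)) := by
    have h1 : q (rcomm (left G a) (right G b)) = 1 := (QuotientGroup.eq_one_iff _).2 hN
    have h2 : q (left G a * right G b) =
        q (right G b * left G a * rcomm (left G a) (right G b)) := by
      congr 1
      rw [rcomm]; group
    rw [map_mul, map_mul q _ (rcomm _ _), h1, mul_one, map_mul] at h2
    exact h2
  have haa : Commute (q (left G a)) (q (right G a)) := (commute_self G a).map q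
  have hbb : Commute (q (left G b)) (q (right G b)) := (commute_self G b).map q
  -- The last of the four pairs: expand the commutation of `a b` with `(a b)*` and cancel using the
  -- other three.
  have hba : Commute (q (left G b)) (q (right G a)) := by
    have h1 := ((commute_self G (a * b)).map q).eq
    simp only [map_mul] at h1
    have h2 : q (left G a) * (q (left G b) * q (right G a)) * q (right G b) =
        q (left G a) * (q (right G a) * q (left G b)) * q (right G b) := by
      calc _ = q (left G a) * q (left G b) * (q (right G a) * q (right G b)) := by group
        _ = q (right G a) * (q (right G b) * q (left G a)) * q (left G b) := by rw [h1]; group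
        _ = (q (right G a) * q (left G a)) * (q (right G b) * q (left G b)) := by
          rw [← hab.eq]; group
        _ = _ := by rw [← haa.eq, ← hbb.eq]; group
    exact mul_left_cancel (mul_right_cancel h2)
  obtain ⟨i, j, rfl⟩ := h.exists_pow x
  obtain ⟨k, l, rfl⟩ := h.exists_pow y
  change Commute (q (left G _)) (q (right G _))
  simp only [map_mul, map_pow]
  exact ((hbb.pow_pow i k).mul_right (hba.pow_pow i l)).mul_left
    ((hab.pow_pow j k).mul_right (haa.pow_pow j l))

/-- Modulo `⟨w⟩`, with `w = [a, b*]`, an element is determined by its first two image coordinates,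
so the kernel lies in `⟨w⟩`. There `w^m = 1`, while the third coordinate `a^(r-1)` of `w` has order
`m`. -/
theorem toTriple_injective (h : IsHolderPair n m r a b) {φ : Tau G →* (Fin 3 → G)}
    (hl : ∀ x, φ (left G x) = ![x, 1, x]) (hr : ∀ x, φ (right G x) = ![1, x, x]) :
    Function.Injective φ := by
  set w := rcomm (left G a) (right G b) with hw
  have := h.tau_normal
  have hform : ∀ t : Tau G, (t : Tau G ⧸ Subgroup.zpowers w) =
      (left G (φ t 0) : Tau G) * (right G (φ t 1) : Tau G) := by
    intro t
    have ht : t ∈ Subgroup.closure (Set.range (left G) ∪ Set.range (right G)) :=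
      (Tau.closure_eq G).symm ▸ Subgroup.mem_top t
    induction ht using Subgroup.closure_induction with
    | mem s hs =>
      rcases hs with ⟨x, rfl⟩ | ⟨x, rfl⟩
      · simp [hl]
      · simp [hr]
    | one => simp
    | mul x y _ _ hx hy =>
      have hc := h.tau_commute_mod (Subgroup.mem_zpowers w) (φ y 0) (φ x 1)
      simp only [map_mul, Pi.mul_apply, QuotientGroup.mk_mul]
      rw [hx, hy]
      exact hc.symm.mul_mul_mul_comm _ _
    | inv x _ hx =>
      have hc := h.tau_commute_mod (Subgroup.mem_zpowers w) (φ x 0) (φ x 1)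
      simp only [map_inv, Pi.inv_apply, QuotientGroup.mk_inv]
      rw [hx, mul_inv_rev, hc.inv_inv.eq]
  rw [injective_iff_map_eq_one]
  intro t ht
  have h1 : t ∈ Subgroup.zpowers w := by
    rw [← QuotientGroup.eq_one_iff, hform, ht]
    simp
  obtain ⟨k, rfl⟩ := h1
  have h2 : φ w 2 = a ^ ((r : ℤ) - 1) := by
    rw [hw, rcomm, map_mul, map_mul, map_mul, map_inv, map_inv, hl, hr]
    simp only [Pi.mul_apply, Pi.inv_apply]
    change a⁻¹ * b⁻¹ * a * b = _
    rw [mul_assoc, mul_assoc, ← mul_assoc b⁻¹, h.conj, sub_eq_neg_add, zpow_add, zpow_neg_one,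
      zpow_natCast]
  have h3 : (a ^ ((r : ℤ) - 1)) ^ k = 1 := by
    rw [← h2, ← Pi.pow_apply, ← map_zpow]
    exact congrFun ht 2
  rw [← zpow_mul, ← orderOf_dvd_iff_zpow_eq_one, h.orderOf_a] at h3
  obtain ⟨l, rfl⟩ := h.param.isCoprime_sub_one.symm.dvd_of_dvd_mul_left h3
  simp only
  rw [zpow_mul, zpow_natCast, h.tau_pow_eq_one, one_zpow]

theorem nonempty_tau_equiv (h : IsHolderPair n m r a b) : Nonempty (Tau G ≃* tauImage G) := by
  obtain ⟨φ, hl, hr⟩ := exists_toTriple G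
  rw [← Tau.range_eq_tauImage hl hr]
  exact ⟨MonoidHom.ofInjective (h.toTriple_injective hl hr)⟩

end IsHolderPair

/-! ### Comparison of `τ(G)` with `K(G,3)`: part (c). -/

theorem IsAIAut.nonempty_equiv {G : Type*} [Group G] {α : MulAut G} (hα : IsAIAut α) :
    Nonempty (tauImage G ≃* liedtkeK G 3) := by
  -- Inverting the third coordinate modulo `G'` turns `x₀x₁ ≡ x₂` into `x₀x₁x₂ ≡ 1`.
  let e : (Fin 3 → G) ≃* (Fin 3 → G) := MulEquiv.piCongrRight ![.refl G, .refl G, α]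
  have he : (tauImage G).map e.toMonoidHom = liedtkeK G 3 := by
    ext x
    obtain ⟨y, rfl⟩ := e.surjective x
    have h1 : e y ∈ (tauImage G).map e.toMonoidHom ↔ y ∈ tauImage G :=
      Subgroup.mem_map_iff_mem e.injective
    rw [h1, mem_tauImage, mem_liedtkeK_three, ← Abelianization.ker_of, MonoidHom.mem_ker, map_mul,
      map_mul]
    change _ ↔ Abelianization.of (y 0) * Abelianization.of (y 1) * Abelianization.of (α (y 2)) = 1
    rw [hα, mul_inv_eq_one]
  rw [← he]
  exact ⟨e.subgroupMap (tauImage G)⟩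

namespace IsHolderPair

variable {G : Type*} [Group G] {n m r : ℕ} {a b : G}

/-- The powers of `a`, with exponents in `ZMod m`, and the action of `G` on them. -/
theorem exists_zmod_pow (h : IsHolderPair n m r a b) : ∃ f : Multiplicative (ZMod m) →* G,
    Function.Injective f ∧ (∀ x, x ^ m = 1 → ∃ v, f v = x) ∧ (∀ v, f v ^ m = 1) ∧
    (∀ v, f v ∈ commutator G) ∧
    ∃ χ : G →* (ZMod m)ˣ, (χ b : ZMod m) = r ∧
      ∀ g v, g⁻¹ * f (.ofAdd v) * g = f (.ofAdd (χ g * v)) := by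
  let z : {f : ℤ →+ Additive G // f m = 0} := ⟨zmultiplesHom _ (Additive.ofMul a), by
    rw [zmultiplesHom_apply, natCast_zsmul, ← ofMul_pow, h.pow_a, ofMul_one]⟩
  let f₀ : ZMod m →+ Additive G := ZMod.lift m z
  let f : Multiplicative (ZMod m) →* G := AddMonoidHom.toMultiplicativeLeft f₀
  have hf : ∀ k : ℤ, f (.ofAdd (k : ZMod m)) = a ^ k := fun k => ZMod.lift_coe m z k
  have hf' : ∀ k : ℕ, f (.ofAdd (k : ZMod m)) = a ^ k := fun k => by
    simpa using hf k
  have hsurj : ∀ v : Multiplicative (ZMod m), ∃ k : ℕ, v = .ofAdd (k : ZMod m) := by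
    have := NeZero.of_pos h.param.m_pos
    exact fun v => ⟨(v.toAdd).val, by simp⟩
  have hpow : ∀ v, f v ∈ Subgroup.zpowers a := by
    intro v
    obtain ⟨k, rfl⟩ := hsurj v
    rw [hf']
    exact pow_mem (Subgroup.mem_zpowers a) k
  obtain ⟨χ, hχa, hχb⟩ := h.exists_character
  refine ⟨f, ?_, ?_, fun v => (h.mem_zpowers_iff _).1 (hpow v), ?_, χ, hχb, ?_⟩
  · rw [injective_iff_map_eq_one]
    intro v hv
    obtain ⟨k, rfl⟩ := hsurj v
    rw [hf', ← orderOf_dvd_iff_pow_eq_one, h.orderOf_a] at hv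
    rw [ofAdd_eq_one]
    exact (ZMod.natCast_eq_zero_iff _ _).2 hv
  · intro x hx
    obtain ⟨k, rfl⟩ := (h.mem_zpowers_iff x).2 hx
    exact ⟨_, hf k⟩
  · rw [h.commutator_eq]
    exact hpow
  · have hb : ∀ v, b⁻¹ * f (.ofAdd v) * b = f (.ofAdd (r * v)) := by
      intro v
      obtain ⟨k, hk⟩ := hsurj (.ofAdd v)
      obtain rfl : v = k := hk
      rw [hf', h.conj_pow, ← Nat.cast_mul, hf']
    have hbi : ∀ (i : ℕ) (v : ZMod m),
        (b ^ i)⁻¹ * f (.ofAdd v) * b ^ i = f (.ofAdd (r ^ i * v)) := by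
      intro i
      induction i with
      | zero => simp
      | succ i ih =>
        intro v
        rw [pow_succ (r : ZMod m), mul_assoc (_ ^ i) _ v, ← ih, ← hb, pow_succ' b]
        group
    intro g v
    obtain ⟨i, j, rfl⟩ := h.exists_pow g
    have hχ : (χ (b ^ i * a ^ j) : ZMod m) = r ^ i := by
      rw [map_mul, map_pow, map_pow, hχa, one_pow, mul_one, Units.val_pow_eq_pow_val, hχb]
    rw [hχ, ← hbi]
    have hc : (a ^ j)⁻¹ * ((b ^ i)⁻¹ * f (.ofAdd v) * b ^ i) * a ^ j =
        (b ^ i)⁻¹ * f (.ofAdd v) * b ^ i := by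
      rw [hbi]
      obtain ⟨k, hk⟩ := hsurj (.ofAdd (r ^ i * v))
      rw [hk, hf', mul_assoc, ← pow_add, add_comm, pow_add, inv_mul_cancel_left]
    rw [← hc]
    group

/-- An isomorphism of the image of `τ(G)` with `K(G, 3)` preserves the determinants of the
actions on the elements whose `m`-th power is trivial. -/
theorem pow_two_modEq_of_equiv (h : IsHolderPair n m r a b) (e : tauImage G ≃* liedtkeK G 3) :
    r ^ 2 ≡ 1 [MOD m] := by
  obtain ⟨f, hinj, hsurj, hpow, hcomm, χ, hχb, hχ⟩ := h.exists_zmod_pow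
  let ι : Multiplicative (Fin 3 → ZMod m) →* (Fin 3 → G) :=
    { toFun v i := f (.ofAdd (v.toAdd i))
      map_one' := by funext i; simp
      map_mul' v w := by funext i; simp }
  have hιinj : Function.Injective ι := fun v w hvw =>
    Multiplicative.toAdd.injective (funext fun i =>
      Multiplicative.ofAdd.injective (hinj (congrFun hvw i)))
  have hιsurj : ∀ x : Fin 3 → G, x ^ m = 1 → ∃ v, ι v = x := by
    intro x hx
    choose v hv using fun i => hsurj (x i) (congrFun hx i)
    exact ⟨.ofAdd fun i => (v i).toAdd, funext hv⟩
  have hιpow : ∀ v, ι v ^ m = 1 := fun v => funext fun i => hpow _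
  have hof : ∀ v, Abelianization.of (f v) = 1 := fun v => by
    rw [← MonoidHom.mem_ker, Abelianization.ker_of]
    exact hcomm v
  have hιT : ∀ v, ι v ∈ tauImage G := fun v => by
    rw [mem_tauImage]
    change Abelianization.of (f _) * .of (f _) = Abelianization.of (f _)
    simp only [hof, one_mul]
  have hιK : ∀ v, ι v ∈ liedtkeK G 3 := fun v => by
    rw [mem_liedtkeK_three]
    exact mul_mem (mul_mem (hcomm _) (hcomm _)) (hcomm _)
  have hιconj : ∀ (x : Fin 3 → G) (v : Fin 3 → ZMod m), x⁻¹ * ι (.ofAdd v) * x =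
      ι (.ofAdd fun i => χ (x i) * v i) := fun x v => funext fun i => hχ (x i) (v i)
  -- The elements killed by `m` form the same free `ZMod m`-module of rank `3` in both groups, so
  -- `e` restricts to an automorphism `L` of it.
  have hL : ∀ v, ∃ w, ι w = e ⟨ι v, hιT v⟩ := fun v => hιsurj _ (by
    rw [← Subgroup.coe_pow, ← map_pow]
    simp [Subtype.ext_iff, hιpow])
  have hL' : ∀ v, ∃ w, ι w = e.symm ⟨ι v, hιK v⟩ := fun v => hιsurj _ (by
    rw [← Subgroup.coe_pow, ← map_pow]
    simp [Subtype.ext_iff, hιpow])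
  choose L hLspec using hL
  choose L' hLspec' using hL'
  have hLL' : ∀ v, L' (L v) = v := fun v => hιinj (by
    rw [hLspec']
    simp [hLspec])
  have hL'L : ∀ v, L (L' v) = v := fun v => hιinj (by
    rw [hLspec]
    simp [hLspec'])
  have hLmul : ∀ v w, L (v * w) = L v * L w := fun v w => hιinj (by
    rw [map_mul, hLspec, hLspec, hLspec, ← Subgroup.coe_mul, ← map_mul]
    congr 2
    exact Subtype.ext (map_mul ι v w))
  let Ladd : (Fin 3 → ZMod m) ≃+ (Fin 3 → ZMod m) :=
    { toFun v := (L (.ofAdd v)).toAdd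
      invFun v := (L' (.ofAdd v)).toAdd
      left_inv := hLL'
      right_inv := hL'L
      map_add' v w := hLmul (.ofAdd v) (.ofAdd w) }
  let Llin : (Fin 3 → ZMod m) ≃ₗ[ZMod m] (Fin 3 → ZMod m) :=
    { Ladd with map_smul' := fun c v => ZMod.map_smul Ladd.toAddMonoidHom c v }
  -- The test element: conjugation by `t` has determinant `r²`, and conjugation by its image under
  -- `e` is similar to it via `L`.
  let t : Fin 3 → G := ![b, 1, b]
  have ht : t ∈ tauImage G := by simp [mem_tauImage, t]
  let D (x : Fin 3 → G) : (Fin 3 → ZMod m) →ₗ[ZMod m] (Fin 3 → ZMod m) :=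
    Matrix.toLin' (Matrix.diagonal fun i => (χ (x i) : ZMod m))
  have hD : ∀ x v, ι (.ofAdd (D x v)) = x⁻¹ * ι (.ofAdd v) * x := by
    intro x v
    rw [hιconj]
    congr 2
    funext i
    simp [D, Matrix.mulVec_diagonal]
  have hdet : ∀ x, LinearMap.det (D x) = χ (x 0) * χ (x 1) * χ (x 2) := by
    intro x
    simp [D, Matrix.det_diagonal, Fin.prod_univ_three]
  have hintertwine : ∀ v, Llin (D t v) = D (e ⟨t, ht⟩ : Fin 3 → G) (Llin v) := by
    intro v
    apply Multiplicative.ofAdd.injective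
    apply hιinj
    rw [hD]
    change ι (L _) = _ * ι (L _) * _
    rw [hLspec, hLspec, ← Subgroup.coe_inv, ← Subgroup.coe_mul, ← Subgroup.coe_mul, ← map_inv,
      ← map_mul, ← map_mul]
    congr 2
    exact Subtype.ext (hD t v)
  have hconj : D (e ⟨t, ht⟩ : Fin 3 → G) = (Llin : _ →ₗ[ZMod m] _) ∘ₗ D t ∘ₗ
      (Llin.symm : _ →ₗ[ZMod m] _) := by
    refine LinearMap.ext fun v => ?_
    obtain ⟨w, rfl⟩ := Llin.surjective v
    simp [hintertwine]
  have h1 := congrArg LinearMap.det hconj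
  rw [LinearMap.det_conj, hdet, hdet] at h1
  -- In `K(G,3)` every determinant is `χ` of the product of the coordinates, hence `1`, because `χ`
  -- kills `G'`.
  have h2 : χ ((e ⟨t, ht⟩ : Fin 3 → G) 0) * χ ((e ⟨t, ht⟩ : Fin 3 → G) 1) *
      χ ((e ⟨t, ht⟩ : Fin 3 → G) 2) = 1 := by
    rw [← map_mul, ← map_mul, ← MonoidHom.mem_ker]
    exact Abelianization.commutator_subset_ker χ ((mem_liedtkeK_three _).1 (e ⟨t, ht⟩).2)
  rw [← Units.val_mul, ← Units.val_mul, h2] at h1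
  simp only [t, Matrix.cons_val_zero, Matrix.cons_val_one, Matrix.cons_val, map_one, Units.val_one,
    mul_one, hχb] at h1
  rw [← ZMod.natCast_eq_natCast_iff]
  push_cast
  rw [h1, sq]

theorem nonempty_kTilde_equiv_tau_iff (h : IsHolderPair n m r a b) {F : Type*} [Group F]
    {π : F →* G} (hπ : Function.Surjective π) :
    Nonempty (KTilde π 3 ≃* Tau G) ↔ ∃ α : MulAut G, IsAIAut α := by
  let eK : KTilde π 3 ≃* liedtkeK G 3 := MulEquiv.ofBijective _ (h.bijective_toK hπ)
  obtain ⟨eT⟩ := h.nonempty_tau_equiv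
  constructor
  · rintro ⟨e⟩
    rw [h.exists_isAIAut_iff]
    exact h.pow_two_modEq_of_equiv ((eT.symm.trans e.symm).trans eK)
  · rintro ⟨α, hα⟩
    obtain ⟨e⟩ := hα.nonempty_equiv
    exact ⟨(eK.trans e.symm).trans eT.symm⟩

end IsHolderPair

/-! ### The theorem assembled. -/

theorem mainTheorem4 {G : Type*} [Group G] [Finite G] :
    -- the groups in question are exactly those in the classification
    (IsZGroup G ↔
      ∃ n m r : ℕ, IsHolderParam n m r ∧ Nonempty (G ≃* HolderGroup n m r)) ∧
    (IsZGroup G →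
      -- the Schur multiplier is trivial
      Subsingleton (SchurMultiplier G) ∧
      -- for every free presentation, the canonical map from `K̃(G,3)` to `K(G,3)` is bijective
      (∀ (X : Type*) (π : FreeGroup X →* G), Function.Surjective π →
        Function.Bijective (KTilde.toK π 3)) ∧
      -- the order, the semidirect decomposition, and part (a)
      (∀ n m r : ℕ, IsHolderParam n m r → Nonempty (G ≃* HolderGroup n m r) →
        Nat.card G = m * n ∧
        (∃ φ : Multiplicative (ZMod n) →* MulAut (Multiplicative (ZMod m)),
          Nonempty (G ≃* Multiplicative (ZMod m) ⋊[φ] Multiplicative (ZMod n))) ∧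
        ((∃ α : MulAut G, IsAIAut α) ↔
          ((∀ x y : G, x * y = y * x) ∨
            (Even n ∧ r ^ 2 ≡ 1 [MOD m] ∧ Nat.gcd (r + 1) m ≠ 1)))) ∧
      -- part (b)
      (Squarefree (Nat.card G) →
        ((∃ α : MulAut G, IsAIAut α) ↔
          ∃ H : Subgroup G, IsHallSubgroup {2}ᶜ H ∧ IsCyclic H)) ∧
      -- part (c)
      (∀ (X : Type*) (π : FreeGroup X →* G), Function.Surjective π →
        (Nonempty (KTilde π 3 ≃* Tau G) ↔ ∃ α : MulAut G, IsAIAut α))) := by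
  refine ⟨isZGroup_iff_exists_isHolderParam, fun hG => ?_⟩
  obtain ⟨n, m, r, a, b, h⟩ := hG.exists_isHolderPair
  refine ⟨h.subsingleton_schurMultiplier, fun X π hπ => h.bijective_toK hπ, ?_,
    h.exists_isAIAut_iff_exists_isHallSubgroup, fun X π hπ => h.nonempty_kTilde_equiv_tau_iff hπ⟩
  -- Part (a) concerns arbitrary admissible parameters, not those produced by the classification, so
  -- a new generating pair is taken.
  rintro n m r hp ⟨e⟩
  obtain ⟨a, b, h'⟩ := exists_isHolderPair_of_equiv hp e
  obtain ⟨φ, c, d, hcd⟩ := hp.exists_isHolderPair_semidirectProduct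
  obtain ⟨e', -⟩ := hcd.exists_equiv
  exact ⟨h'.card_eq, ⟨φ, ⟨e.trans e'⟩⟩, h'.exists_isAIAut_iff'⟩
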